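/- Let $N\ge 2$, let $\Omega\subset\mathbb{R}^N$ be a bounded open set, and write $\omega\subset\subset\Omega$ when $\omega$ is open and $\overline\omega$ is a compact subset of $\Omega$. Let $M(x,s)=(m_{ij}(x,s))_{i,j=1}^N$, where each $m_{ij}:\Omega\times\mathbb{R}\to\mathbb{R}$ is a Carathéodory function (measurable in $x$ for every $s\in\mathbb{R}$, continuous in $s$ for a.e. $x\in\Omega$), and suppose that there are constants $0<\alpha\le\beta$ such that $$\alpha|\varsigma|^2\le M(x,s)\varsigma\cdot\varsigma,\qquad |M(x,s)|\le\beta\qquad\text{for a.e. }x\in\Omega\text{ and all }(s,\varsigma)\in\mathbb{R}\times\mathbb{R}^N,$$ where $|M(x,s)|$ is the Euclidean operator norm. Let $f\in L^\infty_{\rm loc}(\Omega)$ satisfy $\operatorname{ess\,inf}_{\omega} f>0$ for every $\omega\subset\subset\Omega$. Let $h:(0,+\infty)\to[0,+\infty)$ be continuous, with $$\lim_{s\to0^+}\int_s^1\sqrt{h(t)}\,dt<+\infty,$$ and nonincreasing in a neighborhood of zero. Then for every $\omega\subset\subset\Omega$ there is a constant $c_\omega>0$ such that every $z\in H^1_{\rm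 loc}(\Omega)\cap C(\Omega)$ with $z>0$ in $\Omega$ that is a supersolution of $$-\operatorname{div}(M(x,z)\nabla z)+h(z)|\nabla z|^2=f\quad\text{in }\Omega$$ satisfies $z\ge c_\omega$ in $\omega$. Here a supersolution is a function $z\in W^{1,1}_{\rm loc}(\Omega)$ with $z>0$ a.e. in $\Omega$, $h(z)|\nabla z|^2\in L^1_{\rm loc}(\Omega)$ and $$\int_\Omega M(x,z)\nabla z\cdot\nabla\phi+\int_\Omega h(z)|\nabla z|^2\phi\ \ge\ \int_\Omega f\phi\qquad\text{for all }0\le\phi\in C_c^\infty(\Omega).$$ -/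

import Mathlib

open MeasureTheory Set Filter Topology
open scoped ENNReal

namespace QuasilinearElliptic

/-- `ℝᴺ` with its Euclidean norm. -/
abbrev Rn (N : ℕ) : Type := EuclideanSpace ℝ (Fin N)

/-- `ω ⊂⊂ Ω`: `ω` is open, its closure is compact, and that closure is contained in `Ω`. -/
def CompactlyContained {N : ℕ} (ω Ω : Set (Rn N)) : Prop :=
  IsOpen ω ∧ IsCompact (closure ω) ∧ closure ω ⊆ Ω

/-- `u ∈ L^p_loc(Ω)`: `u ∈ L^p(ω)` for every `ω ⊂⊂ Ω`. -/
def MemLpLoc {N : ℕ} {F : Type*} [NormedAddCommGroup F]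
    (u : Rn N → F) (p : ℝ≥0∞) (Ω : Set (Rn N)) : Prop :=
  ∀ ω : Set (Rn N), CompactlyContained ω Ω → MemLp u p (volume.restrict ω)

/-- `φ ∈ C_c^∞(Ω)`. -/
def IsTestFunction {N : ℕ} (Ω : Set (Rn N)) (φ : Rn N → ℝ) : Prop :=
  ContDiff ℝ ((⊤ : ℕ∞) : WithTop ℕ∞) φ ∧ HasCompactSupport φ ∧ tsupport φ ⊆ Ω

/-- `u ∈ W^{1,1}_loc(Ω)` and `G` is (a representative of) its weak gradient. -/
def HasWeakGradient {N : ℕ} (Ω : Set (Rn N)) (u : Rn N → ℝ) (G : Rn N → Rn N) : Prop :=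
  MemLpLoc u 1 Ω ∧ MemLpLoc G 1 Ω ∧
    ∀ φ : Rn N → ℝ, IsTestFunction Ω φ → ∀ i : Fin N,
      ∫ x in Ω, u x * gradient φ x i = - ∫ x in Ω, G x i * φ x

/-- `u ∈ H¹_loc(Ω)`. -/
def MemH1Loc {N : ℕ} (Ω : Set (Rn N)) (u : Rn N → ℝ) : Prop :=
  ∃ G : Rn N → Rn N, HasWeakGradient Ω u G ∧ MemLpLoc u 2 Ω ∧ MemLpLoc G 2 Ω

/-- The coefficients `m_{ij} : Ω × ℝ → ℝ` of `M` are Carathéodory functions: measurable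
(in the sense of Lebesgue) in `x ∈ Ω` for every `s`, continuous in `s` for a.e. `x ∈ Ω`. -/
def IsCaratheodoryMatrix {N : ℕ} (Ω : Set (Rn N))
    (M : Rn N → ℝ → Matrix (Fin N) (Fin N) ℝ) : Prop :=
  ∀ i j : Fin N,
    (∀ s : ℝ, AEMeasurable (fun x => M x s i j) (volume.restrict Ω)) ∧
    (∀ᵐ x ∂(volume.restrict Ω), Continuous (fun s : ℝ => M x s i j))

/-- `α |ς|² ≤ M(x,s)ς · ς` and `|M(x,s)| ≤ β` (Euclidean operator norm)
for a.e. `x ∈ Ω` and all `(s,ς) ∈ ℝ × ℝᴺ`. -/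
def IsUniformlyElliptic {N : ℕ} (Ω : Set (Rn N))
    (M : Rn N → ℝ → Matrix (Fin N) (Fin N) ℝ) (α β : ℝ) : Prop :=
  ∀ᵐ x ∂(volume.restrict Ω), ∀ (s : ℝ) (ς : Rn N),
    α * ‖ς‖ ^ 2 ≤ inner ℝ (Matrix.toEuclideanCLM (𝕜 := ℝ) (M x s) ς) ς ∧
    ‖Matrix.toEuclideanCLM (𝕜 := ℝ) (M x s)‖ ≤ β

/-- `ess inf_ω f > 0` for every `ω ⊂⊂ Ω`. The essential infimum is taken in the extended reals,
so that the condition is void on `ω = ∅`. -/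
def LocallyEssPositive {N : ℕ} (Ω : Set (Rn N)) (f : Rn N → ℝ) : Prop :=
  ∀ ω : Set (Rn N), CompactlyContained ω Ω →
    0 < essInf (fun x => (f x : EReal)) (volume.restrict ω)

/-- `h : (0,∞) → [0,∞)` is continuous, `lim_{s → 0⁺} ∫_s^1 √h(t) dt < ∞`, and `h` is
nonincreasing in a neighborhood of zero. -/
def IsAdmissibleSingularity (h : ℝ → ℝ) : Prop :=
  ContinuousOn h (Ioi 0) ∧ (∀ s : ℝ, 0 < s → 0 ≤ h s) ∧
  (∃ L : ℝ, Tendsto (fun s : ℝ => ∫ t in s..1, Real.sqrt (h t)) (𝓝[>] 0) (𝓝 L)) ∧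
  (∃ δ : ℝ, 0 < δ ∧ AntitoneOn h (Ioo 0 δ))

/-- `u` is a (distributional) supersolution in `Ω` of
`-div (M(x,u)∇u) + g(x,u)|∇u|² = f`. -/
def IsSupersolution {N : ℕ} (Ω : Set (Rn N))
    (M : Rn N → ℝ → Matrix (Fin N) (Fin N) ℝ) (g : Rn N → ℝ → ℝ) (f : Rn N → ℝ)
    (u : Rn N → ℝ) : Prop :=
  ∃ G : Rn N → Rn N, HasWeakGradient Ω u G ∧
    (∀ᵐ x ∂(volume.restrict Ω), 0 < u x) ∧
    MemLpLoc (fun x => g x (u x) * ‖G x‖ ^ 2) 1 Ω ∧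
    ∀ φ : Rn N → ℝ, IsTestFunction Ω φ → (∀ x, 0 ≤ φ x) →
      ∫ x in Ω, f x * φ x ≤
        (∫ x in Ω, inner ℝ (Matrix.toEuclideanCLM (𝕜 := ℝ) (M x (u x)) (G x)) (gradient φ x)) +
        ∫ x in Ω, g x (u x) * ‖G x‖ ^ 2 * φ x

end QuasilinearElliptic

/-! Smallness of a supersolution propagates towards smaller values. There are levels `s n`
decreasing to zero, with steps `d n = s n - s (n + 1)`, and a constant `R` such that `z y ≤ s n`
forces `z y' ≤ s (n + 1)` for some `y'` within distance `2 R √(d n)` of `y`. A point of `ω` with `z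
< s 0` therefore starts a chain of points along which `z` becomes arbitrarily small. If `∑ √(d n)`
is small, the chain stays in a fixed compact subset of `Ω`, where the continuous function `z` has a
positive minimum, which is absurd. So `c = s 0` works, and neither the levels nor `R` involve `z`.

The propagation is `exists_radius`, in contrapositive form. Let `z ≥ s (n + 1)` on the ball and put
`d = d n`, `top = s n + d`, so that `0 < top - z ≤ 2 d` where `z < top`; there `h(z) ≤ 1 / d`. The
exponential weight `exp ((top - z) / (α d))` in the test function absorbs the quadratic gradient
term and is bounded by `exp (2 / α)` independently of `d`. What is left is a Caccioppoli inequality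
for truncations of `top - z`, with the source as an additional good term. On a ball of radius `R √d`
a source of size `lam` can raise `z` by about `lam R² d`. Accordingly, for `R` large the source term
makes the truncation above `d / 4` small in mean square compared with `d`, and De Giorgi's iteration
turns this into `z > top - d = s n` at the centre.

The levels come from `exists_levels`. Solving `1 / d n = h (s (n + 1)) + 1 / s (n + 1)` gives `h ≤ 1
/ d n` on the required range by monotonicity near zero. Since `d (n + 1) / √(d n)` is a step times
the value of `√(h + 1/t)` at its upper end, it is at most the integral of `√h + 1/√t` over that
step. The integrability of `√h` at zero thus makes the total length of the chain small. -/

namespace QuasilinearElliptic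

/-! ### Mollification in `L²` -/

section Mollification

open scoped Convolution ContDiff

variable {E F : Type*} [NormedAddCommGroup E] [InnerProductSpace ℝ E] [FiniteDimensional ℝ E]
  [MeasurableSpace E] [BorelSpace E] [NormedAddCommGroup F] [NormedSpace ℝ F]

/-- Jensen's inequality for the square: the normalised bump is a probability density, and for a
probability measure the `L¹` norm is at most the `L²` norm. -/
theorem enorm_normed_convolution_sq_le (φ : ContDiffBump (0 : E)) {g : E → F}
    (hg : AEStronglyMeasurable g (volume : Measure E)) (x : E) :
    ‖(φ.normed volume ⋆[ContinuousLinearMap.lsmul ℝ ℝ, volume] g) x‖ₑ ^ 2 ≤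
      ∫⁻ t, ENNReal.ofReal (φ.normed volume t) * ‖g (x - t)‖ₑ ^ 2 := by
  set ρ : E → ℝ≥0∞ := fun t => ENNReal.ofReal (φ.normed volume t) with hρ
  have hρm : Measurable ρ := φ.continuous_normed.measurable.ennreal_ofReal
  have hρ1 : ∫⁻ t, ρ t = 1 := by
    rw [hρ, ← ofReal_integral_eq_lintegral_ofReal φ.integrable_normed
      (Eventually.of_forall φ.nonneg_normed), φ.integral_normed, ENNReal.ofReal_one]
  have hgx : AEStronglyMeasurable (fun t => g (x - t)) (volume : Measure E) :=
    hg.comp_quasiMeasurePreserving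
      (Measure.measurePreserving_sub_left volume x).quasiMeasurePreserving
  let ν : Measure E := volume.withDensity ρ
  have hν : IsProbabilityMeasure ν := ⟨by simp [ν, hρ1]⟩
  have hgν : AEStronglyMeasurable (fun t => g (x - t)) ν :=
    hgx.mono_ac (withDensity_absolutelyContinuous _ _)
  have h1 : ‖(φ.normed volume ⋆[ContinuousLinearMap.lsmul ℝ ℝ, volume] g) x‖ₑ ≤
      eLpNorm (fun t => g (x - t)) 1 ν := by
    rw [convolution_lsmul, eLpNorm_one_eq_lintegral_enorm,
      lintegral_withDensity_eq_lintegral_mul₀ hρm.aemeasurable hgx.enorm]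
    refine (enorm_integral_le_lintegral_enorm _).trans (le_of_eq (lintegral_congr fun t => ?_))
    rw [enorm_smul, Pi.mul_apply, Real.enorm_of_nonneg (φ.nonneg_normed t)]
  have h2 : eLpNorm (fun t => g (x - t)) 1 ν ≤ eLpNorm (fun t => g (x - t)) 2 ν :=
    eLpNorm_le_eLpNorm_of_exponent_le (by norm_num) hgν
  calc _ ≤ eLpNorm (fun t => g (x - t)) 2 ν ^ 2 := by gcongr; exact h1.trans h2
    _ = ∫⁻ t, ‖g (x - t)‖ₑ ^ 2 ∂ν := by
      have := eLpNorm_nnreal_pow_eq_lintegral (μ := ν) (f := fun t => g (x - t)) (p := 2)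
        (by norm_num)
      norm_num at this
      exact_mod_cast this
    _ = _ := by
      rw [lintegral_withDensity_eq_lintegral_mul₀ hρm.aemeasurable (hgx.enorm.pow_const 2)]
      rfl

/-- Integrate the pointwise Jensen bound, exchange the integrals and use translation invariance. -/
theorem eLpNorm_two_normed_convolution_le (φ : ContDiffBump (0 : E)) {g : E → F}
    (hg : AEStronglyMeasurable g (volume : Measure E)) :
    eLpNorm (φ.normed volume ⋆[ContinuousLinearMap.lsmul ℝ ℝ, volume] g) 2 volume ≤
      eLpNorm g 2 (volume : Measure E) := by
  have key : ∀ f : E → F, eLpNorm f 2 (volume : Measure E) ^ 2 = ∫⁻ x, ‖f x‖ₑ ^ 2 := fun f => by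
    have := eLpNorm_nnreal_pow_eq_lintegral (μ := (volume : Measure E)) (f := f) (p := 2)
      (by norm_num)
    norm_num at this
    exact_mod_cast this
  rw [← ENNReal.pow_le_pow_left_iff (two_ne_zero), key, key]
  have hρm : Measurable fun t => ENNReal.ofReal (φ.normed (volume : Measure E) t) :=
    φ.continuous_normed.measurable.ennreal_ofReal
  have hρ1 : ∫⁻ t, ENNReal.ofReal (φ.normed (volume : Measure E) t) = 1 := by
    rw [← ofReal_integral_eq_lintegral_ofReal φ.integrable_normed
      (Eventually.of_forall φ.nonneg_normed), φ.integral_normed, ENNReal.ofReal_one]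
  have hsub : AEStronglyMeasurable (fun p : E × E => g (p.1 - p.2))
      ((volume : Measure E).prod volume) :=
    hg.comp_quasiMeasurePreserving (quasiMeasurePreserving_sub_of_right_invariant volume volume)
  calc _ ≤ ∫⁻ x, ∫⁻ t, ENNReal.ofReal (φ.normed (volume : Measure E) t) * ‖g (x - t)‖ₑ ^ 2 :=
        lintegral_mono (enorm_normed_convolution_sq_le φ hg)
    _ = ∫⁻ t, ∫⁻ x, ENNReal.ofReal (φ.normed (volume : Measure E) t) * ‖g (x - t)‖ₑ ^ 2 := by
      refine lintegral_lintegral_swap ?_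
      exact (hρm.comp measurable_snd).aemeasurable.mul (hsub.enorm.pow_const 2)
    _ = ∫⁻ t, ENNReal.ofReal (φ.normed (volume : Measure E) t) * ∫⁻ x, ‖g x‖ₑ ^ 2 := by
      refine lintegral_congr fun t => ?_
      rw [lintegral_const_mul' _ _ ENNReal.ofReal_ne_top,
        lintegral_sub_right_eq_self (fun x => ‖g x‖ₑ ^ 2) t]
    _ = _ := by rw [lintegral_mul_const _ hρm, hρ1, one_mul]

/-- Contractivity in `L²` reduces the claim to a continuous compactly supported `k`. Its
mollifications converge uniformly and, once the radius is below 1, differ from `k` only inside a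
fixed compact set. -/
theorem tendsto_eLpNorm_two_normed_convolution_sub [CompleteSpace F] {φ : ℕ → ContDiffBump (0 : E)}
    (hφ : Tendsto (fun n => (φ n).rOut) atTop (𝓝 0)) {g : E → F}
    (hg : MemLp g 2 (volume : Measure E)) :
    Tendsto (fun n => eLpNorm
      ((φ n).normed volume ⋆[ContinuousLinearMap.lsmul ℝ ℝ, volume] g - g) 2 volume)
      atTop (𝓝 0) := by
  rw [ENNReal.tendsto_atTop_zero]
  intro ε hε
  obtain ⟨ε', hε', hεε'⟩ : ∃ ε' : ℝ≥0∞, 0 < ε' ∧ ε' + ε' + ε' ≤ ε := by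
    refine ⟨ε / 3, ENNReal.div_pos hε.ne' (by norm_num), ?_⟩
    rw [ENNReal.add_thirds]
  obtain ⟨k, hkc, hk, hkcont, hk2⟩ := hg.exists_hasCompactSupport_eLpNorm_sub_le
    (by norm_num) hε'.ne'
  -- uniform convergence for `k`
  set S : Set E := Metric.cthickening 1 (tsupport k) with hS
  have hSc : IsCompact S := hkc.isCompact.cthickening
  have hSfin : (volume : Measure E) S ≠ ⊤ := hSc.measure_lt_top.ne
  obtain ⟨η, hη, hηS⟩ : ∃ η : ℝ, 0 < η ∧
      volume S ^ (2 : ℝ≥0∞).toReal⁻¹ * ENNReal.ofReal η ≤ ε' := by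
    have hc : volume S ^ (2 : ℝ≥0∞).toReal⁻¹ ≠ ⊤ :=
      ENNReal.rpow_ne_top_of_nonneg (by norm_num) hSfin
    have : Tendsto (fun η : ℝ => volume S ^ (2 : ℝ≥0∞).toReal⁻¹ * ENNReal.ofReal η) (𝓝[>] 0)
        (𝓝 0) := by
      have h1 : Tendsto (fun η : ℝ => ENNReal.ofReal η) (𝓝[>] 0) (𝓝 0) := by
        have := (ENNReal.continuous_ofReal.tendsto (0 : ℝ)).mono_left
          (nhdsWithin_le_nhds (s := Ioi 0))
        simpa using this
      simpa using ENNReal.Tendsto.const_mul h1 (Or.inr hc)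
    obtain ⟨η, h1, h2⟩ := ((this.eventually_le_const hε').and self_mem_nhdsWithin).exists
    exact ⟨η, h2, h1⟩
  have huc : UniformContinuous k := hkc.uniformContinuous_of_continuous hkcont
  obtain ⟨δ, hδ, hkδ⟩ := Metric.uniformContinuous_iff.1 huc η hη
  have hev : ∀ᶠ n in atTop, (φ n).rOut < min δ 1 :=
    hφ.eventually_lt_const (lt_min hδ one_pos)
  obtain ⟨n₀, hn₀⟩ := eventually_atTop.1 hev
  refine ⟨n₀, fun n hn => le_trans ?_ hεε'⟩
  have hr := hn₀ n hn
  have hkm : AEStronglyMeasurable k (volume : Measure E) := hk2.1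
  have hgl := hg.locallyIntegrable (by norm_num)
  have hkl := hk2.locallyIntegrable (by norm_num)
  have hex : ∀ f : E → F, LocallyIntegrable f (volume : Measure E) →
      ConvolutionExists ((φ n).normed volume) f (ContinuousLinearMap.lsmul ℝ ℝ) volume :=
    fun f hf => (φ n).hasCompactSupport_normed.convolutionExists_left _
      (φ n).continuous_normed hf
  have hsplit : (φ n).normed volume ⋆[ContinuousLinearMap.lsmul ℝ ℝ, volume] g - g =
      (φ n).normed volume ⋆[ContinuousLinearMap.lsmul ℝ ℝ, volume] (g - k) +
        ((φ n).normed volume ⋆[ContinuousLinearMap.lsmul ℝ ℝ, volume] k - k) + (k - g) := by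
    have : (φ n).normed volume ⋆[ContinuousLinearMap.lsmul ℝ ℝ, volume] g =
        (φ n).normed volume ⋆[ContinuousLinearMap.lsmul ℝ ℝ, volume] (g - k) +
        (φ n).normed volume ⋆[ContinuousLinearMap.lsmul ℝ ℝ, volume] k := by
      rw [← (hex _ (hgl.sub hkl)).distrib_add (hex _ hkl), sub_add_cancel]
    rw [this]; abel
  have hcc : Continuous ((φ n).normed volume ⋆[ContinuousLinearMap.lsmul ℝ ℝ, volume] k) :=
    (φ n).hasCompactSupport_normed.continuous_convolution_left _ (φ n).continuous_normed hkl
  have hgk : AEStronglyMeasurable (g - k) (volume : Measure E) := hg.1.sub hkm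
  have hcg : Continuous ((φ n).normed volume ⋆[ContinuousLinearMap.lsmul ℝ ℝ, volume] (g - k)) :=
    (φ n).hasCompactSupport_normed.continuous_convolution_left _ (φ n).continuous_normed
      (hgl.sub hkl)
  rw [hsplit]
  refine (eLpNorm_add_le (hcg.aestronglyMeasurable.add (hcc.aestronglyMeasurable.sub hkm))
    (hkm.sub hg.1) (by norm_num)).trans ?_
  refine add_le_add ((eLpNorm_add_le hcg.aestronglyMeasurable
    (hcc.aestronglyMeasurable.sub hkm) (by norm_num)).trans (add_le_add ?_ ?_)) ?_
  · exact (eLpNorm_two_normed_convolution_le (φ n) hgk).trans hk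
  · have hb : ∀ x, ‖((φ n).normed volume ⋆[ContinuousLinearMap.lsmul ℝ ℝ, volume] k - k) x‖ ≤ η :=
      fun x => by
        rw [Pi.sub_apply, ← dist_eq_norm]
        refine ContDiffBump.dist_normed_convolution_le hkm fun y hy => (hkδ ?_).le
        exact (Metric.mem_ball.1 hy).trans (hr.trans_le (min_le_left _ _))
    have hz : ∀ x ∉ S, ((φ n).normed volume ⋆[ContinuousLinearMap.lsmul ℝ ℝ, volume] k - k) x = 0 :=
      fun x hx => by
        have h0 : ∀ y ∈ Metric.ball x (φ n).rOut, k y = 0 := fun y hy => by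
          by_contra hne
          refine hx (Metric.mem_cthickening_of_dist_le x y 1 _ (subset_tsupport k hne) ?_)
          rw [dist_comm]
          exact ((Metric.mem_ball.1 hy).trans (hr.trans_le (min_le_right _ _))).le
        have hx0 : k x = 0 := h0 x (Metric.mem_ball_self (φ n).rOut_pos)
        rw [Pi.sub_apply, ContDiffBump.normed_convolution_eq_right (fun y hy => by
          rw [h0 y hy, hx0]), sub_self]
    have hind : ((φ n).normed volume ⋆[ContinuousLinearMap.lsmul ℝ ℝ, volume] k - k) =
        S.indicator ((φ n).normed volume ⋆[ContinuousLinearMap.lsmul ℝ ℝ, volume] k - k) := by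
      ext x
      by_cases hx : x ∈ S
      · rw [indicator_of_mem hx]
      · rw [indicator_of_notMem hx, hz x hx]
    rw [hind, eLpNorm_indicator_eq_eLpNorm_restrict hSc.measurableSet]
    refine (eLpNorm_le_of_ae_bound (Eventually.of_forall hb)).trans ?_
    rwa [Measure.restrict_apply_univ]
  · rw [← eLpNorm_neg, neg_sub]; exact hk

end Mollification

theorem compactlyContained_thickening {N : ℕ} {K Ω : Set (Rn N)} (hK : IsCompact K) {ε : ℝ}
    (hε : Metric.cthickening ε K ⊆ Ω) : CompactlyContained (Metric.thickening ε K) Ω := by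
  have hsub := Metric.closure_thickening_subset_cthickening ε K
  exact ⟨Metric.isOpen_thickening, hK.cthickening.of_isClosed_subset isClosed_closure hsub,
    hsub.trans hε⟩

theorem MemLpLoc.memLp_isCompact {N : ℕ} {F : Type*} [NormedAddCommGroup F] {u : Rn N → F}
    {p : ℝ≥0∞} {Ω : Set (Rn N)} (hu : MemLpLoc u p Ω) (hΩ : IsOpen Ω) {K : Set (Rn N)}
    (hK : IsCompact K) (hKΩ : K ⊆ Ω) : MemLp u p (volume.restrict K) := by
  obtain ⟨ε, hε, hεΩ⟩ := hK.exists_cthickening_subset_open hΩ hKΩ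
  exact (hu _ (compactlyContained_thickening hK hεΩ)).mono_measure
    (Measure.restrict_mono (Metric.self_subset_thickening hε K) le_rfl)

theorem gradient_apply_eq_fderiv {N : ℕ} (φ : Rn N → ℝ) (x : Rn N) (i : Fin N) :
    gradient φ x i = fderiv ℝ φ x (EuclideanSpace.single i 1) := by
  have h : inner ℝ (gradient φ x) (EuclideanSpace.single i (1 : ℝ)) = gradient φ x i := by
    rw [EuclideanSpace.inner_single_right]; simp
  rw [← h, gradient, InnerProductSpace.toDual_symm_apply]

/-! ### Smooth approximation of functions with a weak gradient -/

section Approximation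

open scoped Convolution ContDiff

theorem fderiv_normed_convolution_apply {N : ℕ} (φ : ContDiffBump (0 : Rn N)) {u : Rn N → ℝ}
    (hu : LocallyIntegrable u (volume : Measure (Rn N))) (x e : Rn N) :
    fderiv ℝ (φ.normed volume ⋆[ContinuousLinearMap.lsmul ℝ ℝ, volume] u) x e =
      ∫ t, fderiv ℝ (φ.normed volume) (x - t) e * u t := by
  have hC1 : ContDiff ℝ 1 (φ.normed (volume : Measure (Rn N))) := φ.contDiff_normed
  rw [(φ.hasCompactSupport_normed.hasFDerivAt_convolution_left
    (ContinuousLinearMap.lsmul ℝ ℝ) hC1 hu x).fderiv, convolution_eq_swap]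
  have hex : ConvolutionExistsAt (fderiv ℝ (φ.normed (volume : Measure (Rn N)))) u x
      ((ContinuousLinearMap.lsmul ℝ ℝ : ℝ →L[ℝ] ℝ →L[ℝ] ℝ).precompL (Rn N)) volume :=
    φ.hasCompactSupport_normed.fderiv (𝕜 := ℝ) |>.convolutionExists_left _
      (hC1.continuous_fderiv one_ne_zero) hu x
  rw [ContinuousLinearMap.integral_apply hex.integrable_swap]
  refine integral_congr_ae (Eventually.of_forall fun t => ?_)
  simp [ContinuousLinearMap.precompL_apply]

/-- The reflected and translated kernel `t ↦ ρ (x - t)` is a test function supported in `V`, so the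
definition of the weak gradient moves the derivative from the kernel onto `u`. The indicators give
global integrability and are invisible at such `x`. -/
theorem gradient_normed_convolution_eq {N : ℕ} {Ω : Set (Rn N)} (hΩ : IsOpen Ω) {u : Rn N → ℝ}
    {G : Rn N → Rn N} (hG : HasWeakGradient Ω u G) {V : Set (Rn N)} (hV : CompactlyContained V Ω)
    (φ : ContDiffBump (0 : Rn N)) {x : Rn N} (hx : Metric.closedBall x φ.rOut ⊆ V) :
    gradient (φ.normed volume ⋆[ContinuousLinearMap.lsmul ℝ ℝ, volume] V.indicator u) x =
      (φ.normed volume ⋆[ContinuousLinearMap.lsmul ℝ ℝ, volume] V.indicator G) x := by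
  have hVm : MeasurableSet V := hV.1.measurableSet
  have hVΩ : V ⊆ Ω := subset_closure.trans hV.2.2
  have huI : Integrable (V.indicator u) (volume : Measure (Rn N)) :=
    (integrable_indicator_iff hVm).2 (memLp_one_iff_integrable.1 (hG.1 V hV))
  have hGI : Integrable (V.indicator G) (volume : Measure (Rn N)) :=
    (integrable_indicator_iff hVm).2 (memLp_one_iff_integrable.1 (hG.2.1 V hV))
  set ρ := φ.normed (volume : Measure (Rn N)) with hρ
  have hρs : ContDiff ℝ ∞ ρ := φ.contDiff_normed
  have hρ0 : ∀ t, t ∉ V → ρ (x - t) = 0 := fun t ht => by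
    by_contra hne
    have : x - t ∈ Metric.ball (0 : Rn N) φ.rOut := by
      rw [← φ.support_normed_eq (μ := volume)]; exact hne
    refine ht (hx ?_)
    rw [mem_ball_zero_iff, ← dist_eq_norm, dist_comm] at this
    exact this.le
  set ψ : Rn N → ℝ := fun t => ρ (x - t) with hψ
  have hts : tsupport ψ ⊆ Metric.closedBall x φ.rOut := by
    refine closure_minimal (fun t ht => ?_) Metric.isClosed_closedBall
    have : x - t ∈ Metric.ball (0 : Rn N) φ.rOut := by
      rw [← φ.support_normed_eq (μ := volume)]; exact ht
    rw [mem_ball_zero_iff, ← dist_eq_norm, dist_comm] at this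
    exact this.le
  have hψt : IsTestFunction Ω ψ :=
    ⟨hρs.comp (contDiff_const.sub contDiff_id),
      (isCompact_closedBall x φ.rOut).of_isClosed_subset (isClosed_tsupport _) hts,
      hts.trans (hx.trans hVΩ)⟩
  have hgψ : ∀ t i, gradient ψ t i = - fderiv ℝ ρ (x - t) (EuclideanSpace.single i 1) :=
    fun t i => by
      rw [gradient_apply_eq_fderiv]
      have h1 : HasFDerivAt (fun t : Rn N => x - t) (-ContinuousLinearMap.id ℝ (Rn N)) t :=
        (hasFDerivAt_id t).const_sub x
      have h2 := ((hρs.differentiable (by simp)) (x - t)).hasFDerivAt.comp t h1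
      rw [show ψ = ρ ∘ fun t => x - t from rfl, h2.fderiv]
      simp
  have hgψ0 : ∀ t, t ∉ V → ∀ i, gradient ψ t i = 0 := fun t ht i => by
    rw [gradient_apply_eq_fderiv, fderiv_of_notMem_tsupport (𝕜 := ℝ) (fun h => ht (hx (hts h)))]
    rfl
  ext i
  rw [gradient_apply_eq_fderiv, fderiv_normed_convolution_apply φ huI.locallyIntegrable,
    convolution_eq_swap]
  have hex : Integrable (fun t => ρ (x - t) • V.indicator G t) (volume : Measure (Rn N)) := by
    have := (φ.hasCompactSupport_normed (μ := volume)).convolutionExists_left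
      (ContinuousLinearMap.lsmul ℝ ℝ) φ.continuous_normed hGI.locallyIntegrable x
    exact this.integrable_swap
  have hR : (∫ t, (ContinuousLinearMap.lsmul ℝ ℝ (ρ (x - t))) (V.indicator G t)) i =
      ∫ t, ρ (x - t) * V.indicator G t i := by
    have := (EuclideanSpace.proj i : Rn N →L[ℝ] ℝ).integral_comp_comm hex
    simp only [PiLp.proj_apply, PiLp.smul_apply, smul_eq_mul] at this
    exact this.symm
  rw [hR]
  have hw := hG.2.2 ψ hψt i
  have e1 : ∫ t, fderiv ℝ ρ (x - t) (EuclideanSpace.single i 1) * V.indicator u t =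
      - ∫ t in Ω, u t * gradient ψ t i := by
    rw [← integral_neg, ← integral_indicator hΩ.measurableSet]
    refine integral_congr_ae (Eventually.of_forall fun t => ?_)
    by_cases ht : t ∈ V
    · simp only [indicator_of_mem ht, indicator_of_mem (hVΩ ht), hgψ]; ring
    · by_cases htΩ : t ∈ Ω
      · simp [indicator_of_notMem ht, indicator_of_mem htΩ, hgψ0 t ht]
      · simp [indicator_of_notMem ht, indicator_of_notMem htΩ]
  have e2 : ∫ t, ρ (x - t) * V.indicator G t i = ∫ t in Ω, G t i * ψ t := by
    rw [← integral_indicator hΩ.measurableSet]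
    refine integral_congr_ae (Eventually.of_forall fun t => ?_)
    by_cases ht : t ∈ V
    · simp only [indicator_of_mem ht, indicator_of_mem (hVΩ ht), hψ]; ring
    · by_cases htΩ : t ∈ Ω
      · simp [indicator_of_notMem ht, indicator_of_mem htΩ, hψ, hρ0 t ht]
      · simp [indicator_of_notMem ht, indicator_of_notMem htΩ]
  rw [e1, e2, hw, neg_neg]

/-- Local approximation of a continuous function with weak gradient in `L²_loc` by smooth
functions, uniformly for the function and in `L²` for the gradient. -/
theorem exists_contDiff_tendsto {N : ℕ} {Ω : Set (Rn N)} (hΩ : IsOpen Ω) {u : Rn N → ℝ}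
    {G : Rn N → Rn N} (hG : HasWeakGradient Ω u G) (hu : ContinuousOn u Ω)
    (hG2 : MemLpLoc G 2 Ω) {K : Set (Rn N)} (hK : IsCompact K) (hKΩ : K ⊆ Ω) :
    ∃ v : ℕ → Rn N → ℝ, (∀ n, ContDiff ℝ ∞ (v n)) ∧ TendstoUniformlyOn v u atTop K ∧
      Tendsto (fun n => eLpNorm (fun x => gradient (v n) x - G x) 2 (volume.restrict K))
        atTop (𝓝 0) := by
  obtain ⟨ε, hε, hεΩ⟩ := hK.exists_cthickening_subset_open hΩ hKΩ
  set V := Metric.thickening ε K with hVdef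
  have hV : CompactlyContained V Ω := compactlyContained_thickening hK hεΩ
  have hVm : MeasurableSet V := hV.1.measurableSet
  have huI : Integrable (V.indicator u) (volume : Measure (Rn N)) :=
    (integrable_indicator_iff hVm).2 (memLp_one_iff_integrable.1 (hG.1 V hV))
  have hGI : MemLp (V.indicator G) 2 (volume : Measure (Rn N)) :=
    (memLp_indicator_iff_restrict hVm).2 (hG2 V hV)
  let φ : ℕ → ContDiffBump (0 : Rn N) := fun n =>
    ⟨(1 / ((n : ℝ) + 1)) / 2, 1 / ((n : ℝ) + 1), by positivity, half_lt_self (by positivity)⟩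
  have hφ : Tendsto (fun n => (φ n).rOut) atTop (𝓝 0) := tendsto_one_div_add_atTop_nhds_zero_nat
  refine ⟨fun n => (φ n).normed volume ⋆[ContinuousLinearMap.lsmul ℝ ℝ, volume] V.indicator u,
    fun n => ?_, ?_, ?_⟩
  · exact (φ n).hasCompactSupport_normed.contDiff_convolution_left _ (φ n).contDiff_normed
      huI.locallyIntegrable
  · rw [Metric.tendstoUniformlyOn_iff]
    intro η hη
    have huc : UniformContinuousOn u (Metric.cthickening ε K) :=
      hK.cthickening.uniformContinuousOn_of_continuous (hu.mono hεΩ)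
    obtain ⟨δ, hδ, huδ⟩ := Metric.uniformContinuousOn_iff.1 huc (η / 2) (half_pos hη)
    filter_upwards [hφ.eventually_lt_const (lt_min hδ hε)] with n hn x hx
    rw [dist_comm]
    have hxV : x ∈ V := Metric.self_subset_thickening hε K hx
    have hxi : V.indicator u x = u x := indicator_of_mem hxV u
    rw [← hxi]
    refine (ContDiffBump.dist_normed_convolution_le huI.1 (ε := η / 2) fun y hy => ?_).trans_lt
      (half_lt_self hη)
    have hyx : dist y x < min δ ε := (Metric.mem_ball.1 hy).trans hn
    have hyV : y ∈ V := Metric.mem_thickening_iff.2 ⟨x, hx, hyx.trans_le (min_le_right _ _)⟩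
    rw [hxi, indicator_of_mem hyV]
    exact (huδ y (Metric.thickening_subset_cthickening _ _ hyV) x
      (Metric.thickening_subset_cthickening _ _ hxV) (hyx.trans_le (min_le_left _ _))).le
  · refine tendsto_of_tendsto_of_tendsto_of_le_of_le' tendsto_const_nhds
      (tendsto_eLpNorm_two_normed_convolution_sub hφ hGI) (Eventually.of_forall fun _ => zero_le)
      ?_
    filter_upwards [hφ.eventually_lt_const hε] with n hn
    refine le_trans (le_of_eq ?_) (eLpNorm_mono_measure _
      (Measure.restrict_le_self (s := K) (μ := (volume : Measure (Rn N)))))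
    refine eLpNorm_congr_ae ?_
    filter_upwards [ae_restrict_mem hK.measurableSet] with x hx
    have hball : Metric.closedBall x (φ n).rOut ⊆ V := fun y hy =>
      Metric.mem_thickening_iff.2 ⟨x, hx, (Metric.mem_closedBall.1 hy).trans_lt hn⟩
    have hxV : x ∈ V := Metric.self_subset_thickening hε K hx
    rw [gradient_normed_convolution_eq hΩ hG hV (φ n) hball, Pi.sub_apply, indicator_of_mem hxV]

end Approximation

/-! ### Nonlinear test functions `η² g(u)` -/

section Limits

open scoped ContDiff

theorem ENNReal_tendsto_zero_of_forall_le_ofReal_mul {a : ℕ → ℝ≥0∞} {C : ℝ≥0∞} (hC : C ≠ ⊤)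
    (h : ∀ δ : ℝ, 0 < δ → ∀ᶠ n in atTop, a n ≤ ENNReal.ofReal δ * C) :
    Tendsto a atTop (𝓝 0) := by
  rw [ENNReal.tendsto_nhds_zero]
  intro ε hε
  have h1 : Tendsto (fun δ : ℝ => ENNReal.ofReal δ * C) (𝓝[>] 0) (𝓝 0) := by
    have h2 : Tendsto (fun δ : ℝ => ENNReal.ofReal δ) (𝓝[>] 0) (𝓝 0) := by
      have := (ENNReal.continuous_ofReal.tendsto (0 : ℝ)).mono_left
        (nhdsWithin_le_nhds (s := Ioi 0))
      simpa using this
    simpa using ENNReal.Tendsto.mul_const h2 (Or.inr hC)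
  obtain ⟨δ, h3, h4⟩ := ((h1.eventually_le_const hε).and self_mem_nhdsWithin).exists
  exact (h δ h4).mono fun n hn => hn.trans h3

/-- Eventually all values `v n x` with `x ∈ K` lie in one compact interval, so only the uniform
continuity of `Φ` on a compact set is needed. -/
theorem tendstoUniformlyOn_comp_of_isCompact {E : Type*} [PseudoMetricSpace E] {K : Set E}
    (hK : IsCompact K) {v : ℕ → E → ℝ} {u : E → ℝ} (hu : ContinuousOn u K)
    (hv : TendstoUniformlyOn v u atTop K) {Φ : E × ℝ → ℝ} (hΦ : Continuous Φ) :
    TendstoUniformlyOn (fun n x => Φ (x, v n x)) (fun x => Φ (x, u x)) atTop K := by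
  obtain ⟨R, hR⟩ := (hK.image_of_continuousOn hu).isBounded.subset_closedBall 0
  have hR' : ∀ x ∈ K, |u x| ≤ R := fun x hx => by
    simpa using hR (mem_image_of_mem u hx)
  have hc : IsCompact (K ×ˢ Metric.closedBall (0 : ℝ) (R + 1)) :=
    hK.prod (isCompact_closedBall _ _)
  have huc := hc.uniformContinuousOn_of_continuous hΦ.continuousOn
  rw [Metric.uniformContinuousOn_iff] at huc
  rw [Metric.tendstoUniformlyOn_iff] at hv ⊢
  intro ε hε
  obtain ⟨δ, hδ, h⟩ := huc ε hε
  filter_upwards [hv (min δ 1) (lt_min hδ one_pos)] with n hn x hx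
  have h1 := hn x hx
  refine h (x, u x) ⟨hx, ?_⟩ (x, v n x) ⟨hx, ?_⟩ ?_
  · have := hR' x hx
    simp only [mem_closedBall_zero_iff, Real.norm_eq_abs]; linarith
  · have := hR' x hx
    have h2 : |u x - v n x| < 1 := (Real.dist_eq _ _ ▸ h1).trans_le (min_le_right _ _)
    simp only [mem_closedBall_zero_iff, Real.norm_eq_abs]
    have h3 : |v n x| ≤ |u x| + |u x - v n x| := by
      have := abs_sub_abs_le_abs_sub (v n x) (u x)
      rw [abs_sub_comm] at this
      linarith
    linarith
  · rw [Prod.dist_eq, dist_self]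
    exact max_lt hδ (h1.trans_le (min_le_left _ _))

variable {N : ℕ} {K : Set (Rn N)} {F : Type*} [NormedAddCommGroup F] [NormedSpace ℝ F]

theorem tendsto_eLpNorm_sub_smul (hK : IsCompact K) {p : ℝ≥0∞} {c : ℕ → Rn N → ℝ} {c₀ : Rn N → ℝ}
    (hc : TendstoUniformlyOn c c₀ atTop K) {Z : Rn N → F} (hZ : MemLp Z p (volume.restrict K)) :
    Tendsto (fun n => eLpNorm (fun x => (c n x - c₀ x) • Z x) p (volume.restrict K))
      atTop (𝓝 0) := by
  refine ENNReal_tendsto_zero_of_forall_le_ofReal_mul hZ.eLpNorm_ne_top fun δ hδ => ?_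
  filter_upwards [Metric.tendstoUniformlyOn_iff.1 hc δ hδ] with n hn
  refine eLpNorm_le_mul_eLpNorm_of_ae_le_mul ?_ p
  filter_upwards [ae_restrict_mem hK.measurableSet] with x hx
  rw [norm_smul]
  have := hn x hx
  rw [dist_comm, dist_eq_norm] at this
  gcongr

theorem tendsto_eLpNorm_smul_sub (hK : IsCompact K) {p : ℝ≥0∞} {c : ℕ → Rn N → ℝ}
    {c₀ : Rn N → ℝ} (hc₀ : ContinuousOn c₀ K)
    (hc : TendstoUniformlyOn c c₀ atTop K) {W : ℕ → Rn N → F}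
    (hW : Tendsto (fun n => eLpNorm (W n) p (volume.restrict K)) atTop (𝓝 0)) :
    Tendsto (fun n => eLpNorm (fun x => c n x • W n x) p (volume.restrict K))
      atTop (𝓝 0) := by
  obtain ⟨R, hR⟩ := (hK.image_of_continuousOn hc₀).isBounded.subset_closedBall 0
  have hR' : ∀ x ∈ K, |c₀ x| ≤ R := fun x hx => by
    simpa using hR (mem_image_of_mem c₀ hx)
  have hlim : Tendsto (fun n => ENNReal.ofReal (R + 1) * eLpNorm (W n) p (volume.restrict K))
      atTop (𝓝 0) := by
    simpa using ENNReal.Tendsto.const_mul hW (Or.inr ENNReal.ofReal_ne_top)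
  refine tendsto_of_tendsto_of_tendsto_of_le_of_le' tendsto_const_nhds hlim
    (Eventually.of_forall fun _ => zero_le) ?_
  filter_upwards [Metric.tendstoUniformlyOn_iff.1 hc 1 one_pos] with n hn
  refine eLpNorm_le_mul_eLpNorm_of_ae_le_mul ?_ p
  filter_upwards [ae_restrict_mem hK.measurableSet] with x hx
  rw [norm_smul, Real.norm_eq_abs]
  have h1 := hn x hx
  rw [Real.dist_eq] at h1
  have h2 : |c n x| ≤ |c₀ x| + |c₀ x - c n x| := by
    have := abs_sub_abs_le_abs_sub (c n x) (c₀ x)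
    rw [abs_sub_comm] at this
    linarith
  have := hR' x hx
  gcongr
  linarith

/-- This is the shape of the gradient of `η² g(vₙ)`: the scalar coefficients converge uniformly, and
only the field `W n` converges merely in `Lᵖ`. -/
theorem tendsto_eLpNorm_combination_sub (hK : IsCompact K) {p : ℝ≥0∞} (hp : 1 ≤ p)
    {c b : ℕ → Rn N → ℝ}
    {c₀ b₀ : Rn N → ℝ} (hc₀ : ContinuousOn c₀ K) (hb₀ : ContinuousOn b₀ K)
    (hcn : ∀ n, ContinuousOn (c n) K) (hbn : ∀ n, ContinuousOn (b n) K)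
    (hc : TendstoUniformlyOn c c₀ atTop K) (hb : TendstoUniformlyOn b b₀ atTop K)
    {W : ℕ → Rn N → F} {G Z : Rn N → F} (hG : MemLp G p (volume.restrict K))
    (hZ : MemLp Z p (volume.restrict K))
    (hWm : ∀ n, AEStronglyMeasurable (W n) (volume.restrict K))
    (hW : Tendsto (fun n => eLpNorm (fun x => W n x - G x) p (volume.restrict K)) atTop (𝓝 0)) :
    Tendsto (fun n => eLpNorm (fun x => (c n x • W n x + b n x • Z x) -
      (c₀ x • G x + b₀ x • Z x)) p (volume.restrict K)) atTop (𝓝 0) := by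
  have h1 := tendsto_eLpNorm_smul_sub hK hc₀ hc hW
  have h2 := tendsto_eLpNorm_sub_smul hK hc hG
  have h3 := tendsto_eLpNorm_sub_smul hK hb hZ
  have hlim := (h1.add h2).add h3
  simp only [add_zero] at hlim
  refine tendsto_of_tendsto_of_tendsto_of_le_of_le tendsto_const_nhds hlim
    (fun _ => zero_le) fun n => ?_
  have mc : AEStronglyMeasurable (c n) (volume.restrict K) :=
    (hcn n).aestronglyMeasurable hK.measurableSet
  have mb : AEStronglyMeasurable (b n) (volume.restrict K) :=
    (hbn n).aestronglyMeasurable hK.measurableSet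
  have mc₀ : AEStronglyMeasurable c₀ (volume.restrict K) :=
    hc₀.aestronglyMeasurable hK.measurableSet
  have mb₀ : AEStronglyMeasurable b₀ (volume.restrict K) :=
    hb₀.aestronglyMeasurable hK.measurableSet
  have e : (fun x => (c n x • W n x + b n x • Z x) - (c₀ x • G x + b₀ x • Z x)) =
      ((fun x => c n x • (W n x - G x)) + fun x => (c n x - c₀ x) • G x) +
        fun x => (b n x - b₀ x) • Z x := by
    ext x
    simp only [Pi.add_apply, smul_sub, sub_smul]
    abel
  have m1 : AEStronglyMeasurable (fun x => c n x • (W n x - G x)) (volume.restrict K) :=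
    mc.smul ((hWm n).sub hG.1)
  have m2 : AEStronglyMeasurable (fun x => (c n x - c₀ x) • G x) (volume.restrict K) :=
    (mc.sub mc₀).smul hG.1
  have m3 : AEStronglyMeasurable (fun x => (b n x - b₀ x) • Z x) (volume.restrict K) :=
    (mb.sub mb₀).smul hZ.1
  simp only [e]
  exact (eLpNorm_add_le (m1.add m2) m3 hp).trans
    (add_le_add (eLpNorm_add_le m1 m2 hp) le_rfl)

theorem gradient_sq_mul_comp {η v : Rn N → ℝ} {g : ℝ → ℝ} (hη : Differentiable ℝ η)
    (hv : Differentiable ℝ v) (hg : Differentiable ℝ g) (x : Rn N) :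
    gradient (fun y => η y ^ 2 * g (v y)) x =
      (η x ^ 2 * deriv g (v x)) • gradient v x + (2 * η x * g (v x)) • gradient η x := by
  ext i
  have h1 : HasFDerivAt (fun y => η y ^ 2) ((2 * η x) • fderiv ℝ η x) x := by
    simpa using (hη x).hasFDerivAt.pow 2
  have h2 : HasFDerivAt (fun y => g (v y)) (deriv g (v x) • fderiv ℝ v x) x :=
    (hg (v x)).hasDerivAt.comp_hasFDerivAt x (hv x).hasFDerivAt
  rw [gradient_apply_eq_fderiv, show fderiv ℝ (fun y => η y ^ 2 * g (v y)) x = _ from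
    (h1.mul h2).fderiv]
  simp only [add_apply, smul_apply, smul_eq_mul,
    PiLp.add_apply, PiLp.smul_apply, gradient_apply_eq_fderiv]
  ring

theorem continuous_gradient {η : Rn N → ℝ} (hη : ContDiff ℝ 1 η) : Continuous (gradient η) :=
  (InnerProductSpace.toDual ℝ (Rn N)).symm.continuous.comp (hη.continuous_fderiv one_ne_zero)

theorem gradient_eq_zero_of_notMem_tsupport {η : Rn N → ℝ} {x : Rn N} (hx : x ∉ tsupport η) :
    gradient η x = 0 := by
  rw [gradient, fderiv_of_notMem_tsupport (𝕜 := ℝ) hx, map_zero]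

theorem integral_eq_of_tsupport_subset {Ω K : Set (Rn N)} {φ : Rn N → ℝ} (hΩ : IsOpen Ω)
    (hKΩ : K ⊆ Ω) (hφ : ∀ x, x ∉ K → φ x = 0) : ∫ x in Ω, φ x = ∫ x in K, φ x :=
  setIntegral_eq_of_subset_of_forall_sdiff_eq_zero hΩ.measurableSet hKΩ fun x hx => hφ x hx.2

theorem integrable_inner_of_memLp_two {E : Type*} [NormedAddCommGroup E] [InnerProductSpace ℝ E]
    {α : Type*} {_ : MeasurableSpace α} {μ : Measure α} {A X : α → E} (hA : MemLp A 2 μ)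
    (hX : MemLp X 2 μ) : Integrable (fun x => inner ℝ (A x) (X x)) μ := by
  refine (hA.norm.integrable_mul hX.norm).mono' (hA.1.inner hX.1) (Eventually.of_forall fun x => ?_)
  exact norm_inner_le_norm _ _

theorem isFiniteMeasure_restrict_of_isCompact (hK : IsCompact K) :
    IsFiniteMeasure ((volume : Measure (Rn N)).restrict K) :=
  ⟨by simpa using hK.measure_lt_top⟩

theorem memLp_of_continuous_isCompact {F : Type*} [NormedAddCommGroup F] (hK : IsCompact K)
    {W : Rn N → F} (hW : Continuous W)
    (p : ℝ≥0∞) : MemLp W p (volume.restrict K) := by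
  have := isFiniteMeasure_restrict_of_isCompact hK
  obtain ⟨C, hC⟩ := hK.exists_bound_of_continuousOn hW.continuousOn
  exact MemLp.of_bound hW.aestronglyMeasurable C ((ae_restrict_mem hK.measurableSet).mono hC)

theorem memLp_continuousOn_smul (hK : IsCompact K) {c : Rn N → ℝ} {W : Rn N → F} {p : ℝ≥0∞}
    (hc : ContinuousOn c K) (hW : MemLp W p (volume.restrict K)) :
    MemLp (fun x => c x • W x) p (volume.restrict K) := by
  obtain ⟨C, hC⟩ := hK.exists_bound_of_continuousOn hc
  refine hW.of_le_mul (c := C) ((hc.aestronglyMeasurable hK.measurableSet).smul hW.1) ?_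
  filter_upwards [ae_restrict_mem hK.measurableSet] with x hx
  rw [norm_smul]
  gcongr
  exact hC x hx

/-- The weak gradient of `η² g(u)`. -/
noncomputable def cutoffGradient (η u : Rn N → ℝ) (G : Rn N → Rn N) (g : ℝ → ℝ) (x : Rn N) : Rn N :=
  (η x ^ 2 * deriv g (u x)) • G x + (2 * η x * g (u x)) • gradient η x

theorem memLp_cutoffGradient (hK : IsCompact K) {η u : Rn N → ℝ} {G : Rn N → Rn N} {g : ℝ → ℝ}
    (hη : ContDiff ℝ ∞ η) (hu : ContinuousOn u K) (hG : MemLp G 2 (volume.restrict K))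
    (hg : ContDiff ℝ ∞ g) : MemLp (cutoffGradient η u G g) 2 (volume.restrict K) := by
  have hgd : Continuous (deriv g) := hg.continuous_deriv (by simp)
  have hgc : Continuous g := hg.continuous
  have hηc : Continuous η := hη.continuous
  exact (memLp_continuousOn_smul hK (by fun_prop) hG).add (memLp_continuousOn_smul hK (by fun_prop)
    (memLp_of_continuous_isCompact hK
      (continuous_gradient (hη.of_le (by exact_mod_cast le_top))) 2))

/-- `η² g(u)` is approximated by functions `η² g(vₙ)` with `vₙ` smooth. -/
theorem exists_cutoff_comp_approx {Ω : Set (Rn N)} (hΩ : IsOpen Ω) {u : Rn N → ℝ}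
    {G : Rn N → Rn N} (hG : HasWeakGradient Ω u G) (hu : ContinuousOn u Ω)
    (hG2 : MemLpLoc G 2 Ω) (hK : IsCompact K) (hKΩ : K ⊆ Ω)
    {g : ℝ → ℝ} (hg : ContDiff ℝ ∞ g) {η : Rn N → ℝ} (hη : ContDiff ℝ ∞ η)
    (hηK : tsupport η ⊆ K) :
    ∃ φ : ℕ → Rn N → ℝ, (∀ n, ContDiff ℝ ∞ (φ n)) ∧ (∀ n, tsupport (φ n) ⊆ K) ∧
      (∀ n x, ∃ t, φ n x = η x ^ 2 * g t) ∧
      TendstoUniformlyOn φ (fun x => η x ^ 2 * g (u x)) atTop K ∧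
      Tendsto (fun n => eLpNorm (gradient (φ n) - cutoffGradient η u G g) 2 (volume.restrict K))
        atTop (𝓝 0) := by
  obtain ⟨v, hv, hvu, hvG⟩ := exists_contDiff_tendsto hΩ hG hu hG2 hK hKΩ
  have huK : ContinuousOn u K := hu.mono hKΩ
  have hgd : Continuous (deriv g) := hg.continuous_deriv (by simp)
  have hgc : Continuous g := hg.continuous
  have hηc : Continuous η := hη.continuous
  have hη1 : ContDiff ℝ 1 η := hη.of_le (by exact_mod_cast le_top)
  have U : ∀ {Φ : Rn N × ℝ → ℝ}, Continuous Φ →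
      TendstoUniformlyOn (fun n x => Φ (x, v n x)) (fun x => Φ (x, u x)) atTop K := fun hΦ =>
    tendstoUniformlyOn_comp_of_isCompact hK huK hvu hΦ
  have U1 := U (Φ := fun p => η p.1 ^ 2 * deriv g p.2) (by fun_prop)
  have U2 := U (Φ := fun p => 2 * η p.1 * g p.2) (by fun_prop)
  have U3 := U (Φ := fun p => η p.1 ^ 2 * g p.2) (by fun_prop)
  have hv1 : ∀ n, ContDiff ℝ 1 (v n) := fun n => (hv n).of_le (by exact_mod_cast le_top)
  have hvc : ∀ n, Continuous (v n) := fun n => (hv n).continuous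
  refine ⟨fun n x => η x ^ 2 * g (v n x), fun n => (hη.pow 2).mul (hg.comp (hv n)), fun n => ?_,
    fun n x => ⟨_, rfl⟩, U3, ?_⟩
  · refine Subset.trans (closure_mono fun x hx => ?_) hηK
    intro h0
    exact hx (by simp [h0])
  · have hlim := tendsto_eLpNorm_combination_sub hK (p := 2) (by norm_num)
      (c := fun n x => η x ^ 2 * deriv g (v n x)) (b := fun n x => 2 * η x * g (v n x))
      (c₀ := fun x => η x ^ 2 * deriv g (u x)) (b₀ := fun x => 2 * η x * g (u x))
      (by fun_prop) (by fun_prop) (fun n => by have := hvc n; fun_prop)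
      (fun n => by have := hvc n; fun_prop) U1 U2 (hG2.memLp_isCompact hΩ hK hKΩ)
      (memLp_of_continuous_isCompact hK (continuous_gradient hη1) 2)
      (fun n => (continuous_gradient (hv1 n)).aestronglyMeasurable) hvG
    refine hlim.congr fun n => eLpNorm_congr_ae (Eventually.of_forall fun x => ?_)
    simp only [Pi.sub_apply, cutoffGradient]
    rw [gradient_sq_mul_comp (hη1.differentiable one_ne_zero) ((hv1 n).differentiable one_ne_zero)
      (hg.differentiable (by simp)) x]

/-- Testing a weak inequality with `η² g(u)`. -/
theorem weak_inequality_comp {Ω : Set (Rn N)} (hΩ : IsOpen Ω) {u : Rn N → ℝ}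
    {G : Rn N → Rn N} (hG : HasWeakGradient Ω u G) (hu : ContinuousOn u Ω)
    (hG2 : MemLpLoc G 2 Ω) (hK : IsCompact K) (hKΩ : K ⊆ Ω)
    {A : Rn N → Rn N} (hA : MemLp A 2 (volume.restrict K)) {f H : Rn N → ℝ}
    (hf : IntegrableOn f K) (hH : IntegrableOn H K)
    (hineq : ∀ φ, IsTestFunction Ω φ → (∀ x, 0 ≤ φ x) →
      ∫ x in Ω, f x * φ x ≤ (∫ x in Ω, inner ℝ (A x) (gradient φ x)) + ∫ x in Ω, H x * φ x)
    {g : ℝ → ℝ} (hg : ContDiff ℝ ∞ g) (hg0 : ∀ t, 0 ≤ g t) {η : Rn N → ℝ} (hη : ContDiff ℝ ∞ η)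
    (hηK : tsupport η ⊆ K) :
    ∫ x in K, f x * (η x ^ 2 * g (u x)) ≤
      (∫ x in K, inner ℝ (A x) (cutoffGradient η u G g x)) +
        ∫ x in K, H x * (η x ^ 2 * g (u x)) := by
  obtain ⟨φ, hφs, hφK, hφv, hφu, hφG⟩ :=
    exists_cutoff_comp_approx hΩ hG hu hG2 hK hKΩ hg hη hηK
  have huK : ContinuousOn u K := hu.mono hKΩ
  have hgc : Continuous g := hg.continuous
  have hηc : Continuous η := hη.continuous
  have hφt : ∀ n, IsTestFunction Ω (φ n) := fun n =>
    ⟨hφs n, hK.of_isClosed_subset (isClosed_tsupport _) (hφK n), (hφK n).trans hKΩ⟩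
  have hφ0 : ∀ n x, x ∉ K → φ n x = 0 := fun n x hx =>
    image_eq_zero_of_notMem_tsupport fun h => hx (hφK n h)
  have hin : ∀ n, ∫ x in K, f x * φ n x ≤ (∫ x in K, inner ℝ (A x) (gradient (φ n) x)) +
      ∫ x in K, H x * φ n x := fun n => by
    have := hineq (φ n) (hφt n) fun x => by
      obtain ⟨t, ht⟩ := hφv n x
      rw [ht]
      exact mul_nonneg (sq_nonneg _) (hg0 _)
    rwa [integral_eq_of_tsupport_subset hΩ hKΩ fun x hx => by rw [hφ0 n x hx, mul_zero],
      integral_eq_of_tsupport_subset hΩ hKΩ fun x hx => by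
        rw [gradient_eq_zero_of_notMem_tsupport fun h => hx (hφK n h), inner_zero_right],
      integral_eq_of_tsupport_subset hΩ hKΩ fun x hx => by rw [hφ0 n x hx, mul_zero]] at this
  -- The lower order term is merely integrable, so the test functions must converge uniformly; this
  -- is where the continuity of `u` enters.
  have L1 : ∀ {f : Rn N → ℝ}, IntegrableOn f K → Tendsto (fun n => ∫ x in K, f x * φ n x) atTop
      (𝓝 (∫ x in K, f x * (η x ^ 2 * g (u x)))) := fun {f} hf => by
    have hint : ∀ {c : Rn N → ℝ}, ContinuousOn c K → IntegrableOn (fun x => f x * c x) K :=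
      fun hc => hf.mul_continuousOn hc hK
    refine tendsto_integral_of_L1' _ (Integrable.aestronglyMeasurable (hint (by fun_prop)))
      (Eventually.of_forall fun n => hint (hφs n).continuous.continuousOn) ?_
    refine (tendsto_eLpNorm_sub_smul hK hφu (memLp_one_iff_integrable.2 hf)).congr fun n => ?_
    refine eLpNorm_congr_ae (Eventually.of_forall fun x => ?_)
    simp only [smul_eq_mul, Pi.sub_apply]
    ring
  have L2 : Tendsto (fun n => ∫ x in K, inner ℝ (A x) (gradient (φ n) x)) atTop
      (𝓝 (∫ x in K, inner ℝ (A x) (cutoffGradient η u G g x))) := by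
    have hX2 := memLp_cutoffGradient hK hη huK (hG2.memLp_isCompact hΩ hK hKΩ) hg
    have hXn : ∀ n, MemLp (gradient (φ n)) 2 (volume.restrict K) := fun n =>
      memLp_of_continuous_isCompact hK
        (continuous_gradient ((hφs n).of_le (by exact_mod_cast le_top))) 2
    refine tendsto_integral_of_L1' _ (integrable_inner_of_memLp_two hA hX2).aestronglyMeasurable
      (Eventually.of_forall fun n => integrable_inner_of_memLp_two hA (hXn n)) ?_
    have hlim := ENNReal.Tendsto.const_mul hφG (Or.inr hA.eLpNorm_ne_top)
    rw [mul_zero] at hlim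
    refine tendsto_of_tendsto_of_tendsto_of_le_of_le tendsto_const_nhds hlim
      (fun _ => zero_le) fun n => ?_
    have hh := eLpNorm_le_eLpNorm_mul_eLpNorm_of_nnnorm (p := 2) (q := 2) (r := 1) hA.1
      ((hXn n).sub hX2).1 (fun a b : Rn N => (inner ℝ a b : ℝ)) 1
      (Eventually.of_forall fun x => by
        rw [one_mul]; exact nnnorm_inner_le_nnnorm (𝕜 := ℝ) _ _)
    rw [ENNReal.coe_one, one_mul] at hh
    refine le_trans (le_of_eq (eLpNorm_congr_ae (Eventually.of_forall fun x => ?_))) hh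
    simp only [Pi.sub_apply, inner_sub_right]
  exact le_of_tendsto_of_tendsto' (L1 hf) (L2.add (L1 hH)) hin

/-- The Gagliardo–Nirenberg–Sobolev inequality for `η² g(u)`. -/
theorem eLpNorm_cutoff_comp_le {Ω : Set (Rn N)} (hΩ : IsOpen Ω) {u : Rn N → ℝ}
    {G : Rn N → Rn N} (hG : HasWeakGradient Ω u G) (hu : ContinuousOn u Ω)
    (hG2 : MemLpLoc G 2 Ω) (hK : IsCompact K) (hKΩ : K ⊆ Ω)
    {g : ℝ → ℝ} (hg : ContDiff ℝ ∞ g) {η : Rn N → ℝ} (hη : ContDiff ℝ ∞ η)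
    (hηK : tsupport η ⊆ K) {p : NNReal} (hp : NNReal.HolderConjugate (N : NNReal) p) :
    eLpNorm (fun x => η x ^ 2 * g (u x)) p (volume.restrict K) ≤
      eLpNormLESNormFDerivOneConst (volume : Measure (Rn N)) p *
        eLpNorm (cutoffGradient η u G g) 1 (volume.restrict K) := by
  obtain ⟨φ, hφs, hφK, hφv, hφu, hφG⟩ :=
    exists_cutoff_comp_approx hΩ hG hu hG2 hK hKΩ hg hη hηK
  set μ := (volume : Measure (Rn N)).restrict K with hμ
  have hfin : IsFiniteMeasure μ := isFiniteMeasure_restrict_of_isCompact hK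
  set C : ℝ≥0∞ := ((eLpNormLESNormFDerivOneConst (volume : Measure (Rn N)) p : NNReal) : ℝ≥0∞)
    with hC
  set w : Rn N → ℝ := fun x => η x ^ 2 * g (u x) with hw
  have huK : ContinuousOn u K := hu.mono hKΩ
  have hgc : Continuous g := hg.continuous
  have hηc : Continuous η := hη.continuous
  have hwK : ContinuousOn w K := by fun_prop
  have hwm : AEStronglyMeasurable w μ := hwK.aestronglyMeasurable hK.measurableSet
  have hp1 : (1 : ℝ≥0∞) ≤ p := by exact_mod_cast hp.symm.lt.le
  have hφ1 : ∀ n, ContDiff ℝ 1 (φ n) := fun n => (hφs n).of_le (by exact_mod_cast le_top)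
  have hX2 := memLp_cutoffGradient hK hη huK (hG2.memLp_isCompact hΩ hK hKΩ) hg
  have hgm : ∀ n, AEStronglyMeasurable (gradient (φ n)) μ := fun n =>
    (continuous_gradient (hφ1 n)).aestronglyMeasurable
  -- The endpoint embedding of `W^{1,1}` into `Lᵖ` with `p = N / (N - 1)`. It will be applied to
  -- squares, so `N = 2` needs no separate treatment.
  have hS : ∀ n, eLpNorm (φ n) p μ ≤ C * eLpNorm (gradient (φ n)) 1 μ := fun n => by
    have h1 := eLpNorm_le_eLpNorm_fderiv_one (volume : Measure (Rn N)) (hφ1 n)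
      (hK.of_isClosed_subset (isClosed_tsupport _) (hφK n)) (p := p)
      (by rwa [finrank_euclideanSpace_fin])
    refine (eLpNorm_mono_measure _ Measure.restrict_le_self).trans (h1.trans (le_of_eq ?_))
    congr 1
    rw [← eLpNorm_indicator_eq_eLpNorm_restrict hK.measurableSet]
    refine eLpNorm_congr_norm_ae (Eventually.of_forall fun x => ?_)
    by_cases hx : x ∈ K
    · rw [indicator_of_mem hx, gradient, LinearIsometryEquiv.norm_map]
    · rw [indicator_of_notMem hx, fderiv_of_notMem_tsupport (𝕜 := ℝ) fun h => hx (hφK n h),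
        norm_zero, norm_zero]
  have h1 : Tendsto (fun n => eLpNorm (fun x => φ n x - w x) p μ) atTop (𝓝 0) := by
    have := tendsto_eLpNorm_sub_smul hK hφu (Z := fun _ => (1 : ℝ)) (p := p) (memLp_const 1)
    simpa using this
  have h2 : Tendsto (fun n => eLpNorm (gradient (φ n) - cutoffGradient η u G g) 1 μ)
      atTop (𝓝 0) := by
    have hc : μ univ ^ (1 / (1 : ℝ≥0∞).toReal - 1 / (2 : ℝ≥0∞).toReal) ≠ ⊤ :=
      ENNReal.rpow_ne_top_of_nonneg (by norm_num) (measure_ne_top _ _)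
    have hlim := ENNReal.Tendsto.mul_const hφG (Or.inr hc)
    rw [zero_mul] at hlim
    refine tendsto_of_tendsto_of_tendsto_of_le_of_le tendsto_const_nhds hlim
      (fun _ => zero_le) fun n => ?_
    exact eLpNorm_le_eLpNorm_mul_rpow_measure_univ (by norm_num) ((hgm n).sub hX2.1)
  have hlim : Tendsto (fun n => eLpNorm (fun x => φ n x - w x) p μ +
      C * (eLpNorm (gradient (φ n) - cutoffGradient η u G g) 1 μ +
        eLpNorm (cutoffGradient η u G g) 1 μ)) atTop
      (𝓝 (0 + C * (0 + eLpNorm (cutoffGradient η u G g) 1 μ))) :=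
    h1.add (ENNReal.Tendsto.const_mul (h2.add tendsto_const_nhds)
      (Or.inr ENNReal.coe_ne_top))
  rw [zero_add, zero_add] at hlim
  refine ge_of_tendsto' hlim fun n => ?_
  have e1 : w = φ n - fun x => φ n x - w x := by ext x; simp
  have e2 : gradient (φ n) =
      (gradient (φ n) - cutoffGradient η u G g) + cutoffGradient η u G g := by simp
  have hφm : AEStronglyMeasurable (φ n) μ := (hφs n).continuous.aestronglyMeasurable
  calc eLpNorm w p μ ≤ eLpNorm (φ n) p μ + eLpNorm (fun x => φ n x - w x) p μ := by
        conv_lhs => rw [e1]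
        exact eLpNorm_sub_le hφm (hφm.sub hwm) hp1
    _ ≤ C * eLpNorm (gradient (φ n)) 1 μ + eLpNorm (fun x => φ n x - w x) p μ := by
        gcongr; exact hS n
    _ ≤ _ := by
        rw [add_comm]
        gcongr
        conv_lhs => rw [e2]
        exact eLpNorm_add_le ((hgm n).sub hX2.1) hX2.1 le_rfl

end Limits

/-! ### Energy estimates with absorption of the quadratic gradient term -/

section Caccioppoli

open scoped ContDiff

/-- Smooth, convex, nondecreasing functions vanishing on the negative half-line. -/
structure IsTruncation (T : ℝ → ℝ) : Prop where
  contDiff : ContDiff ℝ ∞ T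
  eq_zero : ∀ t ≤ 0, T t = 0
  deriv_eq_zero : ∀ t ≤ 0, deriv T t = 0
  nonneg : ∀ t, 0 ≤ T t
  deriv_nonneg : ∀ t, 0 ≤ deriv T t
  deriv2_nonneg : ∀ t, 0 ≤ deriv (deriv T) t

/-- A continuous function `z` with weak gradient `G` that satisfies
`-div A + H ≥ f` in `Ω`, where on the compact set `K` the flux `A` is coercive and bounded,
`f ≥ lam`, and `H ≤ ‖G‖² / d` where `top - 2 d ≤ z ≤ top`. -/
structure IsLocalSupersolution {N : ℕ} (Ω K : Set (Rn N)) (z : Rn N → ℝ) (G A : Rn N → Rn N)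
    (f H : Rn N → ℝ) (α β lam d top : ℝ) : Prop where
  isOpen : IsOpen Ω
  weakGradient : HasWeakGradient Ω z G
  continuousOn : ContinuousOn z Ω
  memLp : MemLpLoc G 2 Ω
  isCompact : IsCompact K
  subset : K ⊆ Ω
  memLp_flux : MemLp A 2 (volume.restrict K)
  integrable_source : IntegrableOn f K
  integrable_lower : IntegrableOn H K
  ineq : ∀ φ, IsTestFunction Ω φ → (∀ x, 0 ≤ φ x) →
      ∫ x in Ω, f x * φ x ≤ (∫ x in Ω, inner ℝ (A x) (gradient φ x)) + ∫ x in Ω, H x * φ x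
  coercive : ∀ᵐ x ∂volume.restrict K, α * ‖G x‖ ^ 2 ≤ inner ℝ (A x) (G x)
  bounded : ∀ᵐ x ∂volume.restrict K, ‖A x‖ ≤ β * ‖G x‖
  le_source : ∀ᵐ x ∂volume.restrict K, lam ≤ f x
  lower_le : ∀ᵐ x ∂volume.restrict K, z x ≤ top → H x ≤ 1 / d * ‖G x‖ ^ 2
  le_z : ∀ x ∈ K, top - 2 * d ≤ z x
  alpha_pos : 0 < α
  beta_nonneg : 0 ≤ β
  lam_pos : 0 < lam
  d_pos : 0 < d

theorem IsLocalSupersolution.mono {N : ℕ} {Ω K K' : Set (Rn N)} {z : Rn N → ℝ} {G A : Rn N → Rn N}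
    {f H : Rn N → ℝ} {α β lam d top : ℝ}
    (hz : IsLocalSupersolution Ω K z G A f H α β lam d top) (hK' : IsCompact K') (h : K' ⊆ K) :
    IsLocalSupersolution Ω K' z G A f H α β lam d top :=
  have hm : (volume : Measure (Rn N)).restrict K' ≤ volume.restrict K :=
    Measure.restrict_mono h le_rfl
  { hz with
    isCompact := hK'
    subset := h.trans hz.subset
    memLp_flux := hz.memLp_flux.mono_measure hm
    integrable_source := hz.integrable_source.mono_set h
    integrable_lower := hz.integrable_lower.mono_set h
    coercive := ae_mono hm hz.coercive
    bounded := ae_mono hm hz.bounded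
    le_source := ae_mono hm hz.le_source
    lower_le := ae_mono hm hz.lower_le
    le_z := fun x hx => hz.le_z x (h hx) }

/-- Here `e` is the exponential weight, `T, T₁, T₂` are the truncation and its first two
derivatives, `a` and `b` are the products of the flux with the gradients of `z` and `η`, and `n` is
the length of the latter gradient. Differentiating the weight `e T T₁` yields three terms: the one
with `1 / (α d)` absorbs `H`, the one with `T₁²` gives the energy, and the one with `T T₂` has a
good sign by convexity. Young's inequality pays for the cross term with half of the energy. -/
theorem caccioppoli_pointwise {α β lam d E e T T₁ T₂ η a b f H G n : ℝ} (hα : 0 < α)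
    (hβ : 0 ≤ β) (hd : 0 < d) (he : 1 ≤ e) (heE : e ≤ E) (hT : 0 ≤ T) (hT₁ : 0 ≤ T₁) (hT₂ : 0 ≤ T₂)
    (ha : α * G ^ 2 ≤ a) (hG : 0 ≤ G) (hn : 0 ≤ n) (hb : |b| ≤ β * G * n) (hlam : 0 ≤ lam)
    (hf : lam ≤ f) (hH : H ≤ 1 / d * G ^ 2) :
    α / 2 * (T₁ ^ 2 * G ^ 2 * η ^ 2) + lam * (T * T₁ * η ^ 2) -
        2 * β ^ 2 * E ^ 2 / α * (T ^ 2 * n ^ 2) ≤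
      f * (η ^ 2 * (e * (T * T₁))) -
        (η ^ 2 * (-(e * (1 / (α * d) * (T * T₁) + T₁ ^ 2 + T * T₂))) * a +
          2 * η * (e * (T * T₁)) * b) - H * (η ^ 2 * (e * (T * T₁))) := by
  have he0 : 0 ≤ e := by linarith
  have hE0 : 0 ≤ E := by linarith
  have hP : 0 ≤ η ^ 2 * (e * (T * T₁)) := by positivity
  have hα0 : 0 ≤ α * G ^ 2 := by positivity
  have ha0 : 0 ≤ a := hα0.trans ha
  have h1 : lam * (T * T₁ * η ^ 2) ≤ f * (η ^ 2 * (e * (T * T₁))) := by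
    have h2 : T * T₁ * η ^ 2 ≤ η ^ 2 * (e * (T * T₁)) := by
      have : 0 ≤ T * T₁ * η ^ 2 := by positivity
      nlinarith
    exact mul_le_mul hf h2 (by positivity) (hlam.trans hf)
  have h2 : H * (η ^ 2 * (e * (T * T₁))) ≤ η ^ 2 * (e * (1 / (α * d) * (T * T₁))) * a := by
    calc H * (η ^ 2 * (e * (T * T₁))) ≤ 1 / d * G ^ 2 * (η ^ 2 * (e * (T * T₁))) := by gcongr
      _ = η ^ 2 * (e * (1 / (α * d) * (T * T₁))) * (α * G ^ 2) := by field_simp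
      _ ≤ _ := by gcongr
  have h3 : α * (T₁ ^ 2 * G ^ 2 * η ^ 2) ≤ η ^ 2 * (e * T₁ ^ 2) * a := by
    calc α * (T₁ ^ 2 * G ^ 2 * η ^ 2) = η ^ 2 * (1 * T₁ ^ 2) * (α * G ^ 2) := by ring
      _ ≤ _ := by gcongr
  have h4 : 0 ≤ η ^ 2 * (e * (T * T₂)) * a := by positivity
  have h5 : 2 * η * (e * (T * T₁)) * b ≤
      α / 2 * (T₁ ^ 2 * G ^ 2 * η ^ 2) + 2 * β ^ 2 * E ^ 2 / α * (T ^ 2 * n ^ 2) := by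
    have h6 : 2 * η * (e * (T * T₁)) * b ≤ 2 * (|η| * T₁ * G) * (β * E * T * n) := by
      calc 2 * η * (e * (T * T₁)) * b ≤ |2 * η * (e * (T * T₁)) * b| := le_abs_self _
        _ = 2 * |η| * (e * (T * T₁)) * |b| := by
          rw [abs_mul, abs_mul, abs_mul, abs_of_nonneg (by positivity : 0 ≤ e * (T * T₁)),
            abs_of_pos (by norm_num : (0 : ℝ) < 2)]
        _ ≤ 2 * |η| * (E * (T * T₁)) * (β * G * n) := by gcongr
        _ = _ := by ring
    have h7 : 2 * (|η| * T₁ * G) * (β * E * T * n) ≤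
        α / 2 * (|η| * T₁ * G) ^ 2 + 2 / α * (β * E * T * n) ^ 2 := by
      have : α / 2 * (|η| * T₁ * G) ^ 2 + 2 / α * (β * E * T * n) ^ 2 -
          2 * (|η| * T₁ * G) * (β * E * T * n) =
          (α * (|η| * T₁ * G) - 2 * (β * E * T * n)) ^ 2 / (2 * α) := by field_simp; ring
      have h8 : 0 ≤ (α * (|η| * T₁ * G) - 2 * (β * E * T * n)) ^ 2 / (2 * α) := by positivity
      linarith
    have h9 : α / 2 * (|η| * T₁ * G) ^ 2 + 2 / α * (β * E * T * n) ^ 2 =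
        α / 2 * (T₁ ^ 2 * G ^ 2 * η ^ 2) + 2 * β ^ 2 * E ^ 2 / α * (T ^ 2 * n ^ 2) := by
      rw [mul_pow, mul_pow, sq_abs]; ring
    linarith
  linarith

theorem IsTruncation.contDiff_deriv {T : ℝ → ℝ} (hT : IsTruncation T) : ContDiff ℝ ∞ (deriv T) :=
  (contDiff_infty_iff_deriv.1 hT.contDiff).2

theorem IsTruncation.hasDerivAt_weight {T : ℝ → ℝ} (hT : IsTruncation T) (κ top s : ℝ) :
    HasDerivAt (fun s => Real.exp (κ * (top - s)) * (T (top - s) * deriv T (top - s)))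
      (-(Real.exp (κ * (top - s)) * (κ * (T (top - s) * deriv T (top - s)) +
        deriv T (top - s) ^ 2 + T (top - s) * deriv (deriv T) (top - s)))) s := by
  have h0 : HasDerivAt (fun s : ℝ => top - s) (-1) s := by
    simpa using (hasDerivAt_id s).const_sub top
  have h1 : HasDerivAt (fun s => T (top - s)) (deriv T (top - s) * -1) s :=
    ((hT.contDiff.differentiable (by simp)) (top - s)).hasDerivAt.comp s h0
  have h2 : HasDerivAt (fun s => deriv T (top - s)) (deriv (deriv T) (top - s) * -1) s :=
    ((hT.contDiff_deriv.differentiable (by simp)) (top - s)).hasDerivAt.comp s h0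
  have h3 := (h0.const_mul κ).exp
  refine (h3.mul (h1.mul h2)).congr_deriv ?_
  simp only [Pi.mul_apply]
  ring

variable {N : ℕ} {Ω K : Set (Rn N)} {z : Rn N → ℝ} {G A : Rn N → Rn N}
    {f H : Rn N → ℝ} {α β lam d top : ℝ}

theorem IsLocalSupersolution.continuousOn_K
    (hz : IsLocalSupersolution Ω K z G A f H α β lam d top) : ContinuousOn z K :=
  hz.continuousOn.mono hz.subset

theorem IsLocalSupersolution.integrableOn_comp
    (hz : IsLocalSupersolution Ω K z G A f H α β lam d top) {c : Rn N → ℝ} (hc : ContinuousOn c K) :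
    IntegrableOn c K :=
  hc.integrableOn_compact hz.isCompact

theorem IsLocalSupersolution.integrableOn_norm_sq
    (hz : IsLocalSupersolution Ω K z G A f H α β lam d top) {T : ℝ → ℝ} (hT : IsTruncation T)
    {η : Rn N → ℝ} (hη : Continuous η) :
    IntegrableOn (fun x => deriv T (top - z x) ^ 2 * ‖G x‖ ^ 2 * η x ^ 2) K := by
  have hG : MemLp G 2 (volume.restrict K) :=
    hz.memLp.memLp_isCompact hz.isOpen hz.isCompact hz.subset
  have hzK := hz.continuousOn_K
  have hTd := hT.contDiff_deriv.continuous
  have h1 : IntegrableOn (fun x => ‖G x‖ ^ 2) K := hG.integrable_norm_pow (by norm_num)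
  have h2 : IntegrableOn (fun x => ‖G x‖ ^ 2 * (deriv T (top - z x) ^ 2 * η x ^ 2)) K :=
    h1.mul_continuousOn (by fun_prop) hz.isCompact
  refine h2.congr_fun (fun x _ => by ring) hz.isCompact.measurableSet

/-- The test function is `η² e^{κ(top - z)} T T'`, with `T` and `T'` taken at `top - z`. The value
`κ = 1 / (α d)` is what absorbs a quadratic term of size `1 / d`, and `top - z ≤ 2 d` bounds the
exponential by `exp (2 / α)`, so the constants do not depend on `d`. The source is kept on the left,
since it starts the iteration. -/
theorem IsLocalSupersolution.caccioppoli
    (hz : IsLocalSupersolution Ω K z G A f H α β lam d top) {T : ℝ → ℝ} (hT : IsTruncation T)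
    {η : Rn N → ℝ} (hη : ContDiff ℝ ∞ η) (hηK : tsupport η ⊆ K) :
    α / 2 * (∫ x in K, deriv T (top - z x) ^ 2 * ‖G x‖ ^ 2 * η x ^ 2) +
        lam * (∫ x in K, T (top - z x) * deriv T (top - z x) * η x ^ 2) ≤
      2 * β ^ 2 * Real.exp (2 / α) ^ 2 / α * ∫ x in K, T (top - z x) ^ 2 * ‖gradient η x‖ ^ 2 := by
  have hα := hz.alpha_pos
  have hd := hz.d_pos
  set κ : ℝ := 1 / (α * d) with hκ
  set g : ℝ → ℝ := fun s => Real.exp (κ * (top - s)) * (T (top - s) * deriv T (top - s)) with hg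
  have hTs := hT.contDiff
  have hTd := hT.contDiff_deriv
  have hTc := hTs.continuous
  have hTdc := hTd.continuous
  have hηc := hη.continuous
  have hη1 : ContDiff ℝ 1 η := hη.of_le (by exact_mod_cast le_top)
  have hgη := continuous_gradient hη1
  have hgs : ContDiff ℝ ∞ g := by
    have h0 : ContDiff ℝ ∞ fun s : ℝ => top - s := contDiff_const.sub contDiff_id
    exact (Real.contDiff_exp.comp (contDiff_const.mul h0)).mul ((hTs.comp h0).mul (hTd.comp h0))
  have hg0 : ∀ t, 0 ≤ g t := fun t =>
    mul_nonneg (Real.exp_pos _).le (mul_nonneg (hT.nonneg _) (hT.deriv_nonneg _))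
  have hgc := hgs.continuous
  have hzK := hz.continuousOn_K
  have hG : MemLp G 2 (volume.restrict K) :=
    hz.memLp.memLp_isCompact hz.isOpen hz.isCompact hz.subset
  have hw := weak_inequality_comp hz.isOpen hz.weakGradient hz.continuousOn hz.memLp hz.isCompact
    hz.subset hz.memLp_flux hz.integrable_source hz.integrable_lower hz.ineq hgs hg0 hη hηK
  have i1 : IntegrableOn (fun x => f x * (η x ^ 2 * g (z x))) K :=
    hz.integrable_source.mul_continuousOn (by fun_prop) hz.isCompact
  have i2 : IntegrableOn (fun x => H x * (η x ^ 2 * g (z x))) K :=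
    hz.integrable_lower.mul_continuousOn (by fun_prop) hz.isCompact
  have i3 : IntegrableOn (fun x => inner ℝ (A x) (cutoffGradient η z G g x)) K :=
    integrable_inner_of_memLp_two hz.memLp_flux (memLp_cutoffGradient hz.isCompact hη hzK hG hgs)
  have j1 := hz.integrableOn_norm_sq hT hηc
  have j2 : IntegrableOn (fun x => T (top - z x) * deriv T (top - z x) * η x ^ 2) K :=
    hz.integrableOn_comp (by fun_prop)
  have j3 : IntegrableOn (fun x => T (top - z x) ^ 2 * ‖gradient η x‖ ^ 2) K :=
    hz.integrableOn_comp (by fun_prop)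
  set Cc : ℝ := 2 * β ^ 2 * Real.exp (2 / α) ^ 2 / α with hCc
  have key : ∫ x in K, (α / 2 * (deriv T (top - z x) ^ 2 * ‖G x‖ ^ 2 * η x ^ 2) +
        lam * (T (top - z x) * deriv T (top - z x) * η x ^ 2) -
        Cc * (T (top - z x) ^ 2 * ‖gradient η x‖ ^ 2)) ≤
      ∫ x in K, (f x * (η x ^ 2 * g (z x)) - inner ℝ (A x) (cutoffGradient η z G g x) -
        H x * (η x ^ 2 * g (z x))) := by
    refine integral_mono_ae (((j1.const_mul _).add (j2.const_mul _)).sub (j3.const_mul _))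
      ((i1.sub i3).sub i2) ?_
    filter_upwards [hz.coercive, hz.bounded, hz.le_source, hz.lower_le,
      ae_restrict_mem hz.isCompact.measurableSet] with x h1 h2 h3 h4 h5
    have hX : inner ℝ (A x) (cutoffGradient η z G g x) =
        η x ^ 2 * deriv g (z x) * inner ℝ (A x) (G x) +
          2 * η x * g (z x) * inner ℝ (A x) (gradient η x) := by
      simp only [cutoffGradient, inner_add_right, inner_smul_right]
    have hgd : deriv g (z x) = _ := (hT.hasDerivAt_weight κ top (z x)).deriv
    simp only [hX, hgd]
    -- Where `z ≥ top`, the weight and its derivative vanish because `T` and `T'` do.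
    rcases le_or_gt (top - z x) 0 with hneg | hpos
    · simp [hg, hT.eq_zero _ hneg, hT.deriv_eq_zero _ hneg]
    · have hu2 := hz.le_z x h5
      refine caccioppoli_pointwise hα hz.beta_nonneg hd (Real.one_le_exp (by positivity))
        (Real.exp_le_exp.2 ?_) (hT.nonneg _) (hT.deriv_nonneg _) (hT.deriv2_nonneg _) h1
        (norm_nonneg _) (norm_nonneg _) ?_ hz.lam_pos.le h3 (h4 (by linarith))
      · rw [hκ, div_mul_eq_mul_div, one_mul, div_le_div_iff₀ (by positivity) hα]
        nlinarith
      · refine (abs_real_inner_le_norm _ _).trans ?_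
        gcongr
  have s1 : IntegrableOn (fun x => α / 2 * (deriv T (top - z x) ^ 2 * ‖G x‖ ^ 2 * η x ^ 2) +
      lam * (T (top - z x) * deriv T (top - z x) * η x ^ 2)) K :=
    (j1.const_mul _).add (j2.const_mul _)
  have s2 : IntegrableOn (fun x => f x * (η x ^ 2 * g (z x)) -
      inner ℝ (A x) (cutoffGradient η z G g x)) K := i1.sub i3
  rw [integral_sub s1 (j3.const_mul _), integral_add (j1.const_mul _) (j2.const_mul _), integral_const_mul, integral_const_mul,
    integral_const_mul, integral_sub s2 i2, integral_sub i1 i3] at key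
  linarith

/-- Sobolev's inequality combined with the Caccioppoli inequality. -/
theorem IsLocalSupersolution.eLpNorm_le
    (hz : IsLocalSupersolution Ω K z G A f H α β lam d top) {T : ℝ → ℝ} (hT : IsTruncation T)
    {η : Rn N → ℝ} (hη : ContDiff ℝ ∞ η) (hηK : tsupport η ⊆ K) (hη0 : ∀ x, 0 ≤ η x)
    (hη1 : ∀ x, η x ≤ 1) {L : ℝ} (hL : 0 < L) (hηL : ∀ x, ‖gradient η x‖ ≤ L)
    {p : NNReal} (hp : NNReal.HolderConjugate (N : NNReal) p) :
    eLpNorm (fun x => η x ^ 2 * T (top - z x) ^ 2) p (volume.restrict K) ≤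
      ENNReal.ofReal (eLpNormLESNormFDerivOneConst (volume : Measure (Rn N)) p *
        ((3 + 4 * β ^ 2 * Real.exp (2 / α) ^ 2 / α ^ 2) * L *
          ∫ x in K, T (top - z x) ^ 2)) := by
  have hα := hz.alpha_pos
  have hTs := hT.contDiff
  have hTc := hTs.continuous
  have hTdc := hT.contDiff_deriv.continuous
  have hηc := hη.continuous
  have hηC1 : ContDiff ℝ 1 η := hη.of_le (by exact_mod_cast le_top)
  have hgη := continuous_gradient hηC1
  have hzK := hz.continuousOn_K
  have hG : MemLp G 2 (volume.restrict K) :=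
    hz.memLp.memLp_isCompact hz.isOpen hz.isCompact hz.subset
  have := isFiniteMeasure_restrict_of_isCompact hz.isCompact
  -- The `W^{1,1}` embedding is applied to `η² T²`, whose gradient is quadratic in quantities that
  -- the Caccioppoli inequality controls.
  set g : ℝ → ℝ := fun s => T (top - s) ^ 2 with hg
  have hgs : ContDiff ℝ ∞ g := by
    have h0 : ContDiff ℝ ∞ fun s : ℝ => top - s := contDiff_const.sub contDiff_id
    exact (hTs.comp h0).pow 2
  have hgd : ∀ s, deriv g s = -(2 * T (top - s) * deriv T (top - s)) := fun s => by
    have h0 : HasDerivAt (fun s : ℝ => top - s) (-1) s := by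
      simpa using (hasDerivAt_id s).const_sub top
    have h1 : HasDerivAt (fun s => T (top - s)) (deriv T (top - s) * -1) s :=
      ((hTs.differentiable (by simp)) (top - s)).hasDerivAt.comp s h0
    rw [show deriv g s = _ from (h1.pow 2).deriv]
    norm_num
  refine (eLpNorm_cutoff_comp_le hz.isOpen hz.weakGradient hz.continuousOn hz.memLp hz.isCompact
    hz.subset hgs hη hηK hp).trans ?_
  have hX2 := memLp_cutoffGradient hz.isCompact hη hzK hG hgs
  have hX1 : Integrable (cutoffGradient η z G g) (volume.restrict K) :=
    hX2.integrable (by norm_num)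
  rw [ENNReal.ofReal_mul NNReal.zero_le_coe, ENNReal.ofReal_coe_nnreal,
    eLpNorm_one_eq_lintegral_enorm, ← ofReal_integral_norm_eq_lintegral_enorm hX1]
  refine mul_le_mul_right (ENNReal.ofReal_le_ofReal ?_) _
  have hcac := hz.caccioppoli hT hη hηK
  set U := ∫ x in K, T (top - z x) ^ 2 with hU
  have j1 := hz.integrableOn_norm_sq hT hηc
  have j0 : IntegrableOn (fun x => T (top - z x) ^ 2) K := hz.integrableOn_comp (by fun_prop)
  have j3 : IntegrableOn (fun x => T (top - z x) ^ 2 * ‖gradient η x‖ ^ 2) K :=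
    hz.integrableOn_comp (by fun_prop)
  have hb1 : ∫ x in K, T (top - z x) ^ 2 * ‖gradient η x‖ ^ 2 ≤ L ^ 2 * U := by
    rw [hU, ← integral_const_mul]
    refine integral_mono j3 (j0.const_mul _) fun x => ?_
    have : ‖gradient η x‖ ^ 2 ≤ L ^ 2 := by gcongr; exact hηL x
    simp only
    nlinarith [sq_nonneg (T (top - z x))]
  have hb2 : 0 ≤ lam * ∫ x in K, T (top - z x) * deriv T (top - z x) * η x ^ 2 :=
    mul_nonneg hz.lam_pos.le (integral_nonneg fun x =>
      mul_nonneg (mul_nonneg (hT.nonneg _) (hT.deriv_nonneg _)) (sq_nonneg _))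
  set I := ∫ x in K, deriv T (top - z x) ^ 2 * ‖G x‖ ^ 2 * η x ^ 2 with hI
  set E2 := β ^ 2 * Real.exp (2 / α) ^ 2 with hE2
  have hI1 : I ≤ 4 * E2 / α ^ 2 * L ^ 2 * U := by
    have h1 : α / 2 * I ≤ 2 * E2 / α * (L ^ 2 * U) := by
      have h2 : 2 * β ^ 2 * Real.exp (2 / α) ^ 2 / α *
          (∫ x in K, T (top - z x) ^ 2 * ‖gradient η x‖ ^ 2) ≤ 2 * E2 / α * (L ^ 2 * U) := by
        rw [hE2, mul_assoc 2 (β ^ 2)]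
        exact mul_le_mul_of_nonneg_left hb1 (by positivity)
      linarith
    calc I = 2 / α * (α / 2 * I) := by field_simp
      _ ≤ 2 / α * (2 * E2 / α * (L ^ 2 * U)) := by gcongr
      _ = _ := by field_simp; ring
  calc ∫ x in K, ‖cutoffGradient η z G g x‖ ≤
        ∫ x in K, (3 * L * T (top - z x) ^ 2 +
          1 / L * (deriv T (top - z x) ^ 2 * ‖G x‖ ^ 2 * η x ^ 2)) := by
        refine integral_mono hX1.norm ((j0.const_mul _).add (j1.const_mul _)) fun x => ?_
        simp only [cutoffGradient]
        refine (norm_add_le _ _).trans ?_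
        rw [norm_smul, norm_smul, hgd, Real.norm_eq_abs, Real.norm_eq_abs]
        have t0 := hT.nonneg (top - z x)
        have t1 := hT.deriv_nonneg (top - z x)
        have e1 := hη0 x
        have e2 := hη1 x
        have n0 := norm_nonneg (G x)
        rw [mul_neg, abs_neg, abs_of_nonneg (by positivity),
          abs_of_nonneg (by simp only [hg]; positivity)]
        simp only [hg]
        set t := T (top - z x)
        set t' := deriv T (top - z x)
        -- Young's inequality with weight `L`: the energy is of order `L² ∫ T²`, so both resulting
        -- terms are of order `L ∫ T²`.
        have a1 : η x ^ 2 * (2 * t * t') * ‖G x‖ ≤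
            L * t ^ 2 + 1 / L * (t' ^ 2 * ‖G x‖ ^ 2 * η x ^ 2) := by
          have b1 : η x ^ 2 * (2 * t * t') * ‖G x‖ ≤ 2 * t * (t' * ‖G x‖ * η x) := by
            have b2 : η x ^ 2 ≤ η x := by nlinarith
            calc η x ^ 2 * (2 * t * t') * ‖G x‖ ≤ η x * (2 * t * t') * ‖G x‖ := by gcongr
              _ = _ := by ring
          have b3 : L * t ^ 2 + 1 / L * (t' ^ 2 * ‖G x‖ ^ 2 * η x ^ 2) -
              2 * t * (t' * ‖G x‖ * η x) = (L * t - t' * ‖G x‖ * η x) ^ 2 / L := by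
            field_simp; ring
          have b4 : 0 ≤ (L * t - t' * ‖G x‖ * η x) ^ 2 / L := by positivity
          linarith
        have a2 : 2 * η x * t ^ 2 * ‖gradient η x‖ ≤ 2 * L * t ^ 2 := by
          calc 2 * η x * t ^ 2 * ‖gradient η x‖ ≤ 2 * 1 * t ^ 2 * L := by
                gcongr; exact hηL x
            _ = _ := by ring
        linarith
    _ = 3 * L * U + 1 / L * I := by
        rw [integral_add (j0.const_mul _) (j1.const_mul _), integral_const_mul, integral_const_mul]
    _ ≤ 3 * L * U + 1 / L * (4 * E2 / α ^ 2 * L ^ 2 * U) := by gcongr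
    _ = _ := by rw [hE2]; field_simp

end Caccioppoli

/-! ### Smooth convex truncations -/

section Truncation

open scoped ContDiff

/-- A smooth convex approximation of the positive part. -/
noncomputable def ramp (t : ℝ) : ℝ := ∫ s in (0 : ℝ)..t, Real.smoothTransition s

theorem hasDerivAt_ramp (t : ℝ) : HasDerivAt ramp (Real.smoothTransition t) t :=
  intervalIntegral.integral_hasDerivAt_right (Real.smoothTransition.continuous.intervalIntegrable _ _)
    (Real.smoothTransition.continuous.stronglyMeasurableAtFilter _ _)
    Real.smoothTransition.continuous.continuousAt

theorem deriv_ramp : deriv ramp = Real.smoothTransition := funext fun t => (hasDerivAt_ramp t).deriv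

theorem contDiff_ramp : ContDiff ℝ ∞ ramp := by
  rw [contDiff_infty_iff_deriv, deriv_ramp]
  exact ⟨fun t => (hasDerivAt_ramp t).differentiableAt, Real.smoothTransition.contDiff⟩

theorem ramp_of_nonpos {t : ℝ} (ht : t ≤ 0) : ramp t = 0 := by
  refine intervalIntegral.integral_zero_ae (Eventually.of_forall fun s hs => ?_)
  rw [uIoc_of_ge ht] at hs
  exact Real.smoothTransition.zero_of_nonpos hs.2

theorem monotone_ramp : Monotone ramp :=
  monotone_of_deriv_nonneg (fun t => (hasDerivAt_ramp t).differentiableAt) fun t => by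
    rw [deriv_ramp]; exact Real.smoothTransition.nonneg t

theorem ramp_nonneg (t : ℝ) : 0 ≤ ramp t := by
  rcases le_total t 0 with h | h
  · rw [ramp_of_nonpos h]
  · rw [← ramp_of_nonpos le_rfl]; exact monotone_ramp h

theorem ramp_one_pos : 0 < ramp 1 :=
  intervalIntegral.intervalIntegral_pos_of_pos_on
    (Real.smoothTransition.continuous.intervalIntegrable _ _)
    (fun _ hs => Real.smoothTransition.pos_of_pos hs.1) one_pos

theorem ramp_le {t : ℝ} (ht : 0 ≤ t) : ramp t ≤ t := by
  have hm : Monotone fun s => s - ramp s := by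
    refine monotone_of_deriv_nonneg
      (fun s => ((hasDerivAt_id s).sub (hasDerivAt_ramp s)).differentiableAt) fun s => ?_
    rw [show deriv (fun s => s - ramp s) s = _ from
      ((hasDerivAt_id s).sub (hasDerivAt_ramp s)).deriv]
    linarith [Real.smoothTransition.le_one s]
  have := hm ht
  simp only [ramp_of_nonpos le_rfl] at this
  linarith

theorem sub_one_le_ramp (t : ℝ) : t - 1 ≤ ramp t := by
  rcases le_total t 1 with h | h
  · linarith [ramp_nonneg t]
  · have h1 : ∫ s in (1 : ℝ)..t, Real.smoothTransition s = t - 1 := by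
      rw [intervalIntegral.integral_congr (g := fun _ => (1 : ℝ)) fun s hs => by
        rw [uIcc_of_le h] at hs
        exact Real.smoothTransition.one_of_one_le hs.1]
      simp
    have h2 : ramp t = ramp 1 + ∫ s in (1 : ℝ)..t, Real.smoothTransition s :=
      (intervalIntegral.integral_add_adjacent_intervals
        (Real.smoothTransition.continuous.intervalIntegrable _ _)
        (Real.smoothTransition.continuous.intervalIntegrable _ _)).symm
    rw [h2, h1]
    linarith [ramp_one_pos]

/-- A smooth convex approximation of `(t - k)⁺` at scale `δ`. -/
noncomputable def trunc (k δ t : ℝ) : ℝ := δ * ramp ((t - k) / δ)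

theorem hasDerivAt_trunc {k δ : ℝ} (hδ : 0 < δ) (t : ℝ) :
    HasDerivAt (trunc k δ) (Real.smoothTransition ((t - k) / δ)) t := by
  have h1 : HasDerivAt (fun t : ℝ => (t - k) / δ) (1 / δ) t :=
    ((hasDerivAt_id t).sub_const k).div_const δ
  have h2 := ((hasDerivAt_ramp ((t - k) / δ)).comp t h1).const_mul δ
  refine h2.congr_deriv ?_
  field_simp

theorem deriv_trunc {k δ : ℝ} (hδ : 0 < δ) :
    deriv (trunc k δ) = fun t => Real.smoothTransition ((t - k) / δ) :=
  funext fun t => (hasDerivAt_trunc hδ t).deriv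

theorem trunc_of_le {k δ t : ℝ} (hδ : 0 < δ) (ht : t ≤ k) : trunc k δ t = 0 := by
  rw [trunc, ramp_of_nonpos (div_nonpos_of_nonpos_of_nonneg (by linarith) hδ.le), mul_zero]

theorem trunc_nonneg {k δ : ℝ} (hδ : 0 < δ) (t : ℝ) : 0 ≤ trunc k δ t :=
  mul_nonneg hδ.le (ramp_nonneg _)

theorem trunc_le {k δ t : ℝ} (hδ : 0 < δ) (ht : k ≤ t) : trunc k δ t ≤ t - k := by
  have := mul_le_mul_of_nonneg_left (ramp_le (div_nonneg (sub_nonneg.2 ht) hδ.le)) hδ.le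
  rwa [mul_div_cancel₀ _ hδ.ne'] at this

theorem sub_le_trunc {k δ : ℝ} (hδ : 0 < δ) (t : ℝ) : t - k - δ ≤ trunc k δ t := by
  have := mul_le_mul_of_nonneg_left (sub_one_le_ramp ((t - k) / δ)) hδ.le
  rwa [mul_sub, mul_div_cancel₀ _ hδ.ne', mul_one] at this

theorem le_trunc {k δ t : ℝ} (hδ : 0 < δ) (ht : k + δ ≤ t) : δ * ramp 1 ≤ trunc k δ t := by
  refine mul_le_mul_of_nonneg_left (monotone_ramp ?_) hδ.le
  rw [le_div_iff₀ hδ]; linarith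

theorem deriv_trunc_eq_one {k δ t : ℝ} (hδ : 0 < δ) (ht : k + δ ≤ t) :
    deriv (trunc k δ) t = 1 := by
  rw [deriv_trunc hδ]
  exact Real.smoothTransition.one_of_one_le (by rw [le_div_iff₀ hδ]; linarith)

theorem isTruncation_trunc {k δ : ℝ} (hk : 0 ≤ k) (hδ : 0 < δ) : IsTruncation (trunc k δ) where
  contDiff := contDiff_const.mul
    (contDiff_ramp.comp ((contDiff_id.sub contDiff_const).div_const δ))
  eq_zero t ht := trunc_of_le hδ (ht.trans hk)
  deriv_eq_zero t ht := by
    rw [deriv_trunc hδ]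
    exact Real.smoothTransition.zero_of_nonpos
      (div_nonpos_of_nonpos_of_nonneg (by linarith) hδ.le)
  nonneg := trunc_nonneg hδ
  deriv_nonneg t := by rw [deriv_trunc hδ]; exact Real.smoothTransition.nonneg _
  deriv2_nonneg t := by
    rw [deriv_trunc hδ]
    refine Monotone.deriv_nonneg fun a b hab => Real.smoothTransition.monotone ?_
    gcongr

end Truncation

/-! ### Cutoff functions between balls -/

section Cutoff

open scoped ContDiff

theorem exists_abs_deriv_smoothTransition_le :
    ∃ B : ℝ, 0 < B ∧ ∀ t, |deriv Real.smoothTransition t| ≤ B := by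
  have hc : Continuous (deriv Real.smoothTransition) :=
    (Real.smoothTransition.contDiff (n := 1)).continuous_deriv le_rfl
  obtain ⟨C, hC⟩ := isCompact_Icc.exists_bound_of_continuousOn
    (hc.continuousOn (s := Icc (0 : ℝ) 1))
  refine ⟨max C 1, lt_max_of_lt_right one_pos, fun t => ?_⟩
  rcases lt_or_ge t 0 with h | h
  · have : Real.smoothTransition =ᶠ[𝓝 t] fun _ => 0 := by
      filter_upwards [Iio_mem_nhds h] with s hs
      exact Real.smoothTransition.zero_of_nonpos (le_of_lt hs)
    rw [this.deriv_eq]; simp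
  · rcases lt_or_ge 1 t with h' | h'
    · have : Real.smoothTransition =ᶠ[𝓝 t] fun _ => 1 := by
        filter_upwards [Ioi_mem_nhds h'] with s hs
        exact Real.smoothTransition.one_of_one_le (le_of_lt hs)
      rw [this.deriv_eq]; simp
    · exact (hC t ⟨h, h'⟩).trans (le_max_left _ _)

/-- Smooth cutoff functions between concentric balls with the natural gradient bound. -/
theorem exists_cutoff (N : ℕ) : ∃ B : ℝ, 0 < B ∧ ∀ (x₀ : Rn N) (ρ ρ' : ℝ), 0 < ρ' → ρ' < ρ →
    ∃ η : Rn N → ℝ, ContDiff ℝ ∞ η ∧ tsupport η ⊆ Metric.closedBall x₀ ρ ∧ (∀ x, 0 ≤ η x) ∧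
      (∀ x, η x ≤ 1) ∧ (∀ x ∈ Metric.closedBall x₀ ρ', η x = 1) ∧
      ∀ x, ‖gradient η x‖ ≤ B / (ρ - ρ') := by
  obtain ⟨B, hB, hder⟩ := exists_abs_deriv_smoothTransition_le
  refine ⟨2 * B, by positivity, fun x₀ ρ ρ' hρ' hρ => ?_⟩
  have hD : 0 < ρ ^ 2 - ρ' ^ 2 := by nlinarith
  -- Squared distances keep `η` smooth at `x₀`. The chain rule factor `2ρ / (ρ² - ρ'²)` is at most
  -- `2 / (ρ - ρ')`.
  set η : Rn N → ℝ := fun x => Real.smoothTransition ((ρ ^ 2 - ‖x - x₀‖ ^ 2) / (ρ ^ 2 - ρ' ^ 2))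
    with hη
  have hsupp : tsupport η ⊆ Metric.closedBall x₀ ρ := by
    refine closure_minimal (fun x hx => ?_) Metric.isClosed_closedBall
    by_contra hne
    rw [Metric.mem_closedBall, not_le, dist_eq_norm] at hne
    refine hx (Real.smoothTransition.zero_of_nonpos
      (div_nonpos_of_nonpos_of_nonneg ?_ hD.le))
    nlinarith
  have hin : ContDiff ℝ ∞ fun x : Rn N => (ρ ^ 2 - ‖x - x₀‖ ^ 2) / (ρ ^ 2 - ρ' ^ 2) :=
    (contDiff_const.sub ((contDiff_id.sub contDiff_const).norm_sq ℝ)).div_const _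
  refine ⟨η, Real.smoothTransition.contDiff.comp hin, hsupp,
    fun x => Real.smoothTransition.nonneg _, fun x => Real.smoothTransition.le_one _,
    fun x hx => ?_, fun x => ?_⟩
  · refine Real.smoothTransition.one_of_one_le ?_
    rw [Metric.mem_closedBall, dist_eq_norm] at hx
    rw [le_div_iff₀ hD]
    nlinarith [norm_nonneg (x - x₀)]
  · by_cases hx : x ∈ tsupport η
    · have hxρ : ‖x - x₀‖ ≤ ρ := by
        have := hsupp hx
        rwa [Metric.mem_closedBall, dist_eq_norm] at this
      have h1 : HasFDerivAt (fun x : Rn N => ‖x - x₀‖ ^ 2) (2 • innerSL ℝ (x - x₀)) x := by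
        have := ((hasFDerivAt_id x).sub_const x₀).norm_sq
        simpa using this
      have h2 : HasFDerivAt (fun x : Rn N => (ρ ^ 2 - ‖x - x₀‖ ^ 2) / (ρ ^ 2 - ρ' ^ 2))
          ((ρ ^ 2 - ρ' ^ 2)⁻¹ • (-(2 • innerSL ℝ (x - x₀)) : Rn N →L[ℝ] ℝ)) x := by
        simpa only [div_eq_inv_mul] using (h1.const_sub (ρ ^ 2)).const_mul (ρ ^ 2 - ρ' ^ 2)⁻¹
      have hd : DifferentiableAt ℝ Real.smoothTransition
          ((ρ ^ 2 - ‖x - x₀‖ ^ 2) / (ρ ^ 2 - ρ' ^ 2)) :=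
        (Real.smoothTransition.contDiff (n := 1)).differentiable one_ne_zero _
      have h3 := hd.hasDerivAt.comp_hasFDerivAt x h2
      rw [gradient, LinearIsometryEquiv.norm_map, show fderiv ℝ η x = _ from h3.fderiv, norm_smul,
        norm_smul, norm_neg, Real.norm_eq_abs, norm_inv, Real.norm_of_nonneg hD.le]
      have h4 : ‖(2 : ℕ) • innerSL ℝ (x - x₀)‖ ≤ 2 * ρ := by
        refine (norm_nsmul_le).trans ?_
        rw [innerSL_apply_norm]
        push_cast
        linarith
      calc _ ≤ B * ((ρ ^ 2 - ρ' ^ 2)⁻¹ * (2 * ρ)) := by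
            gcongr; exact hder _
        _ = 2 * B * (ρ / (ρ ^ 2 - ρ' ^ 2)) := by rw [div_eq_mul_inv]; ring
        _ ≤ 2 * B * (1 / (ρ - ρ')) := by
            gcongr 2 * B * ?_
            rw [div_le_div_iff₀ hD (by linarith)]
            nlinarith
        _ = _ := by ring
    · rw [gradient_eq_zero_of_notMem_tsupport hx, norm_zero]
      have : 0 < ρ - ρ' := by linarith
      positivity

end Cutoff

/-! ### De Giorgi iteration -/

theorem le_geometric_of_recursion {U : ℕ → ℝ} {B : ℝ} {N : ℕ} (hN : N ≠ 0) (hB : 0 ≤ B)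
    (hU : ∀ j, 0 ≤ U j) (hrec : ∀ j, U (j + 1) ≤ B * 4 ^ j * U j * U j ^ (1 / (N : ℝ)))
    (h0 : B * U 0 ^ (1 / (N : ℝ)) ≤ (1 / 4) ^ N) (j : ℕ) : U j ≤ U 0 * ((1 / 4) ^ N) ^ j := by
  induction j with
  | zero => simp
  | succ j ih =>
    -- The ratio `(1 / 4) ^ N` is chosen so that its `N`-th root cancels the growth `4 ^ j` of the
    -- recursion.
    have h1 : U j ^ (1 / (N : ℝ)) ≤ U 0 ^ (1 / (N : ℝ)) * (1 / 4) ^ j := by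
      refine (Real.rpow_le_rpow (hU j) ih (by positivity)).trans (le_of_eq ?_)
      rw [Real.mul_rpow (hU 0) (by positivity), ← pow_mul, mul_comm N j, pow_mul, one_div (N : ℝ),
        Real.pow_rpow_inv_natCast (by positivity) hN]
    have h2 : (4 : ℝ) ^ j * (1 / 4) ^ j = 1 := by rw [← mul_pow]; norm_num
    have hUj := hU j
    have hU0 := Real.rpow_nonneg (hU 0) (1 / (N : ℝ))
    calc U (j + 1) ≤ B * 4 ^ j * U j * U j ^ (1 / (N : ℝ)) := hrec j
      _ ≤ B * 4 ^ j * U j * (U 0 ^ (1 / (N : ℝ)) * (1 / 4) ^ j) := by gcongr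
      _ = B * U 0 ^ (1 / (N : ℝ)) * U j * (4 ^ j * (1 / 4) ^ j) := by ring
      _ = B * U 0 ^ (1 / (N : ℝ)) * U j := by rw [h2, mul_one]
      _ ≤ (1 / 4) ^ N * (U 0 * ((1 / 4) ^ N) ^ j) := by gcongr
      _ = _ := by ring

section DeGiorgi

open scoped ContDiff

/-- The constant in the Sobolev–Caccioppoli inequality. -/
noncomputable def energyConst (N : ℕ) (p : NNReal) (α β : ℝ) : ℝ :=
  eLpNormLESNormFDerivOneConst (volume : Measure (Rn N)) p *
    (3 + 4 * β ^ 2 * Real.exp (2 / α) ^ 2 / α ^ 2)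

theorem energyConst_nonneg (N : ℕ) (p : NNReal) (α β : ℝ) : 0 ≤ energyConst N p α β :=
  mul_nonneg NNReal.zero_le_coe (by positivity)

variable {N : ℕ} {Ω K : Set (Rn N)} {z : Rn N → ℝ} {G A : Rn N → Rn N}
    {f H : Rn N → ℝ} {α β lam d top : ℝ}

theorem measurableSet_inter_lt_of_continuousOn {K' : Set (Rn N)} {w : Rn N → ℝ}
    (hK' : MeasurableSet K') (hw : ContinuousOn w K') (k : ℝ) :
    MeasurableSet (K' ∩ {x | k < w x}) := by
  obtain ⟨u, hu, hu'⟩ := (continuousOn_iff'.1 hw) (Ioi k) isOpen_Ioi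
  have : K' ∩ {x | k < w x} = u ∩ K' := by
    rw [← hu', inter_comm]; rfl
  rw [this]
  exact hu.measurableSet.inter hK'

/-- One step of the De Giorgi iteration. -/
theorem IsLocalSupersolution.integral_sq_le
    (hz : IsLocalSupersolution Ω K z G A f H α β lam d top) (hN : 0 < N) {T T' : ℝ → ℝ}
    (hT : IsTruncation T) (hT' : IsTruncation T') {k m : ℝ} (hm : 0 < m) (hk : ∀ t ≤ k, T' t = 0)
    (hmT : ∀ t, k < t → m ≤ T t) (hTT' : ∀ t, k < t → T' t ≤ T t)
    {η : Rn N → ℝ} (hη : ContDiff ℝ ∞ η) (hηK : tsupport η ⊆ K) (hη0 : ∀ x, 0 ≤ η x)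
    (hη1 : ∀ x, η x ≤ 1) {L : ℝ} (hL : 0 < L) (hηL : ∀ x, ‖gradient η x‖ ≤ L)
    {K' : Set (Rn N)} (hK' : IsCompact K') (hK'K : K' ⊆ K) (hηK' : ∀ x ∈ K', η x = 1)
    {p : NNReal} (hp : NNReal.HolderConjugate (N : NNReal) p) :
    ∫ x in K', T' (top - z x) ^ 2 ≤ energyConst N p α β * L * (∫ x in K, T (top - z x) ^ 2) *
      ((∫ x in K, T (top - z x) ^ 2) / m ^ 2) ^ (1 / (N : ℝ)) := by
  have hTc := hT.contDiff.continuous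
  have hTc' := hT'.contDiff.continuous
  have hηc := hη.continuous
  have hzK := hz.continuousOn_K
  have hzK' := hzK.mono hK'K
  set U := ∫ x in K, T (top - z x) ^ 2 with hU
  have hU0 : 0 ≤ U := integral_nonneg fun x => sq_nonneg _
  set S : Set (Rn N) := K' ∩ {x | k < top - z x} with hS
  have hSm : MeasurableSet S :=
    measurableSet_inter_lt_of_continuousOn hK'.measurableSet (by fun_prop) k
  have hSK' : S ⊆ K' := inter_subset_left
  have hSK : S ⊆ K := hSK'.trans hK'K
  have hSfin : volume S ≠ ⊤ := (measure_mono hSK').trans_lt hK'.measure_lt_top |>.ne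
  have iT : IntegrableOn (fun x => T (top - z x) ^ 2) K := hz.integrableOn_comp (by fun_prop)
  have iT' : IntegrableOn (fun x => T' (top - z x) ^ 2) K := hz.integrableOn_comp (by fun_prop)
  have iη : IntegrableOn (fun x => η x ^ 2 * T (top - z x) ^ 2) K :=
    hz.integrableOn_comp (by fun_prop)
  set w : Rn N → ℝ := fun x => η x ^ 2 * T (top - z x) ^ 2 with hw
  -- `T'` is a second truncation, not a derivative; it vanishes below `k`, so only the superlevel
  -- set `S` counts.
  have h1 : ∫ x in K', T' (top - z x) ^ 2 ≤ ∫ x in S, w x := by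
    rw [setIntegral_eq_of_subset_of_forall_sdiff_eq_zero hK'.measurableSet hSK' fun x hx => by
      have : ¬ k < top - z x := fun h => hx.2 ⟨hx.1, h⟩
      rw [hk _ (not_lt.1 this)]; norm_num]
    refine setIntegral_mono_on (iT'.mono_set hSK) (iη.mono_set hSK) hSm fun x hx => ?_
    have h2 := hT'.nonneg (top - z x)
    have h3 := hTT' _ hx.2
    simp only [hw, hηK' x hx.1, one_pow, one_mul]
    gcongr
  -- Chebyshev's inequality: the lower truncation `T` is at least `m` on `S`.
  have h2 : m ^ 2 * volume.real S ≤ U := by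
    calc m ^ 2 * volume.real S = ∫ x in S, m ^ 2 := by
          rw [setIntegral_const, smul_eq_mul, mul_comm]
      _ ≤ ∫ x in S, T (top - z x) ^ 2 := by
          refine setIntegral_mono_on (integrableOn_const hSfin) (iT.mono_set hSK) hSm
            fun x hx => ?_
          have := hmT _ hx.2
          gcongr
      _ ≤ U := setIntegral_mono_set iT (Eventually.of_forall fun x => sq_nonneg _)
          (LE.le.eventuallyLE hSK)
  have h3 : volume S ≤ ENNReal.ofReal (U / m ^ 2) := by
    rw [← ENNReal.ofReal_toReal hSfin]
    refine ENNReal.ofReal_le_ofReal ?_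
    rw [le_div_iff₀ (by positivity), mul_comm]
    exact h2
  set M := energyConst N p α β * L * U with hM
  have hM0 : 0 ≤ M := mul_nonneg (mul_nonneg (energyConst_nonneg _ _ _ _) hL.le) hU0
  have h4 : eLpNorm w p (volume.restrict S) ≤ ENNReal.ofReal M := by
    refine (eLpNorm_mono_measure _ (Measure.restrict_mono hSK le_rfl)).trans ?_
    refine (hz.eLpNorm_le hT hη hηK hη0 hη1 hL hηL hp).trans (le_of_eq ?_)
    rw [hM, energyConst, hU]
    ring_nf
  have iS : IntegrableOn w S := iη.mono_set hSK
  -- Hölder on `S`: the exponent `1 - 1 / p = 1 / N` of the measure of `S` supplies the superlinear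
  -- gain.
  have h5 : ENNReal.ofReal (∫ x in S, w x) ≤
      ENNReal.ofReal (M * (U / m ^ 2) ^ (1 / (N : ℝ))) := by
    have hw0 : ∀ x, 0 ≤ w x := fun x => by simp only [hw]; positivity
    have e1 : ENNReal.ofReal (∫ x in S, w x) = eLpNorm w 1 (volume.restrict S) := by
      rw [eLpNorm_one_eq_lintegral_enorm, ← ofReal_integral_norm_eq_lintegral_enorm iS]
      congr 1
      exact integral_congr_ae (Eventually.of_forall fun x => (Real.norm_of_nonneg (hw0 x)).symm)
    have hp1 : (1 : ℝ≥0∞) ≤ p := by exact_mod_cast hp.symm.lt.le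
    have e2 : 1 / (1 : ℝ≥0∞).toReal - 1 / (p : ℝ≥0∞).toReal = 1 / (N : ℝ) := by
      have := hp.coe.inv_add_inv_eq_one
      simp only [ENNReal.toReal_one, ENNReal.coe_toReal, NNReal.coe_natCast] at this ⊢
      rw [one_div, one_div, one_div]
      linarith
    rw [e1, ENNReal.ofReal_mul hM0, ← ENNReal.ofReal_rpow_of_nonneg (by positivity) (by positivity)]
    refine (eLpNorm_le_eLpNorm_mul_rpow_measure_univ hp1 iS.aestronglyMeasurable).trans ?_
    rw [e2, Measure.restrict_apply_univ]
    gcongr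
  exact h1.trans ((ENNReal.ofReal_le_ofReal_iff (by positivity)).1 h5)

/-- The absorption term makes the first truncation small. -/
theorem IsLocalSupersolution.integral_sq_le_of_cutoff
    (hz : IsLocalSupersolution Ω K z G A f H α β lam d top) {T : ℝ → ℝ} (hT : IsTruncation T)
    (hT0 : ∀ t ≤ d / 4, T t = 0) (hTt : ∀ t, 0 ≤ t → T t ≤ t)
    {η : Rn N → ℝ} (hη : ContDiff ℝ ∞ η) (hηK : tsupport η ⊆ K)
    {L : ℝ} (hηL : ∀ x, ‖gradient η x‖ ≤ L)
    {K' : Set (Rn N)} (hK' : IsCompact K') (hK'K : K' ⊆ K) (hηK' : ∀ x ∈ K', η x = 1) :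
    ∫ x in K', T (top - z x) ^ 2 ≤
      128 * β ^ 2 * Real.exp (2 / α) ^ 2 / (α * ramp 1) * d ^ 3 * L ^ 2 / lam *
        volume.real K := by
  have hα := hz.alpha_pos
  have hd := hz.d_pos
  have hlam := hz.lam_pos
  have hr := ramp_one_pos
  set T₀ : ℝ → ℝ := trunc 0 (d / 4) with hT₀
  have hd4 : 0 < d / 4 := by positivity
  have hTr : IsTruncation T₀ := isTruncation_trunc le_rfl hd4
  have hTc := hT.contDiff.continuous
  have hT0c := hTr.contDiff.continuous
  have hT0d := hTr.contDiff_deriv.continuous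
  have hηc := hη.continuous
  have hgη := continuous_gradient (hη.of_le (by exact_mod_cast le_top) : ContDiff ℝ 1 η)
  have hzK := hz.continuousOn_K
  have hc := hz.caccioppoli hTr hη hηK
  have i0 : IntegrableOn (fun x => T₀ (top - z x) * deriv T₀ (top - z x) * η x ^ 2) K :=
    hz.integrableOn_comp (by fun_prop)
  have i1 : IntegrableOn (fun x => T (top - z x) ^ 2) K := hz.integrableOn_comp (by fun_prop)
  have i2 : IntegrableOn (fun x => T₀ (top - z x) ^ 2 * ‖gradient η x‖ ^ 2) K :=
    hz.integrableOn_comp (by fun_prop)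
  set J := ∫ x in K, T₀ (top - z x) * deriv T₀ (top - z x) * η x ^ 2 with hJ
  have hu : ∀ x ∈ K, top - z x ≤ 2 * d := fun x hx => by have := hz.le_z x hx; linarith
  have hJ0 : ∀ x, 0 ≤ T₀ (top - z x) * deriv T₀ (top - z x) * η x ^ 2 := fun x =>
    mul_nonneg (mul_nonneg (hTr.nonneg _) (hTr.deriv_nonneg _)) (sq_nonneg _)
  -- Above `d / 4` the auxiliary truncation has slope one and is at least `(d / 4) * ramp 1`, while
  -- `T² ≤ (2 d)²`; the quotient is `16 d / ramp 1`. The integral `J` is the one multiplied by `lam`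
  -- in the Caccioppoli inequality.
  have h1 : ∫ x in K', T (top - z x) ^ 2 ≤ 16 * d / ramp 1 * J := by
    calc ∫ x in K', T (top - z x) ^ 2 ≤
          ∫ x in K', 16 * d / ramp 1 *
            (T₀ (top - z x) * deriv T₀ (top - z x) * η x ^ 2) := by
          refine setIntegral_mono_on (i1.mono_set hK'K) ((i0.mono_set hK'K).const_mul _)
            hK'.measurableSet fun x hx => ?_
          rcases le_or_gt (top - z x) (d / 4) with h | h
          · rw [hT0 _ h]
            have := hJ0 x
            have : 0 ≤ 16 * d / ramp 1 *
              (T₀ (top - z x) * deriv T₀ (top - z x) * η x ^ 2) := by positivity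
            simpa using this
          · have e1 : deriv T₀ (top - z x) = 1 := deriv_trunc_eq_one hd4 (by linarith)
            have e2 : d / 4 * ramp 1 ≤ T₀ (top - z x) := le_trunc hd4 (by linarith)
            have e3 : T (top - z x) ≤ 2 * d :=
              (hTt _ (by linarith)).trans (hu x (hK'K hx))
            rw [e1, hηK' x hx, one_pow, mul_one, mul_one]
            calc T (top - z x) ^ 2 ≤ (2 * d) ^ 2 := by
                  have := hT.nonneg (top - z x)
                  gcongr
              _ = 16 * d / ramp 1 * (d / 4 * ramp 1) := by field_simp; norm_num
              _ ≤ _ := by gcongr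
      _ = 16 * d / ramp 1 *
            ∫ x in K', T₀ (top - z x) * deriv T₀ (top - z x) * η x ^ 2 := integral_const_mul _ _
      _ ≤ _ := by
          gcongr
          exact setIntegral_mono_set i0 (Eventually.of_forall hJ0)
            (LE.le.eventuallyLE hK'K)
  have h2 : ∫ x in K, T₀ (top - z x) ^ 2 * ‖gradient η x‖ ^ 2 ≤
      (2 * d) ^ 2 * L ^ 2 * volume.real K := by
    calc _ ≤ ∫ x in K, (2 * d) ^ 2 * L ^ 2 := by
          refine setIntegral_mono_on i2 (integrableOn_const hz.isCompact.measure_lt_top.ne)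
            hz.isCompact.measurableSet fun x hx => ?_
          have e1 : T₀ (top - z x) ≤ 2 * d := by
            rcases le_total (top - z x) 0 with h | h
            · rw [hTr.eq_zero _ h]; positivity
            · have := trunc_le hd4 h
              have := hu x hx
              simp only [hT₀]; linarith
          have e2 := hηL x
          have e3 := hTr.nonneg (top - z x)
          gcongr
      _ = _ := by rw [setIntegral_const, smul_eq_mul, mul_comm]
  have h3 : 0 ≤ α / 2 * ∫ x in K, deriv T₀ (top - z x) ^ 2 * ‖G x‖ ^ 2 * η x ^ 2 :=
    mul_nonneg (by positivity) (integral_nonneg fun x => by positivity)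
  have h4 : lam * J ≤ 2 * β ^ 2 * Real.exp (2 / α) ^ 2 / α *
      ((2 * d) ^ 2 * L ^ 2 * volume.real K) := by
    have := mul_le_mul_of_nonneg_left h2
      (by positivity : 0 ≤ 2 * β ^ 2 * Real.exp (2 / α) ^ 2 / α)
    linarith
  calc _ ≤ 16 * d / ramp 1 * J := h1
    _ = 16 * d / ramp 1 / lam * (lam * J) := by field_simp
    _ ≤ 16 * d / ramp 1 / lam * (2 * β ^ 2 * Real.exp (2 / α) ^ 2 / α *
      ((2 * d) ^ 2 * L ^ 2 * volume.real K)) := by gcongr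
    _ = _ := by field_simp; ring

end DeGiorgi

/-! ### Lower bound at the centre of a ball of radius proportional to `√d` -/

section Radius

open scoped ContDiff

theorem exists_pos_mul_rpow_le {N : ℕ} (hN : 0 < N) (a b : ℝ) {ε : ℝ} (hε : 0 < ε) :
    ∃ R : ℝ, 0 < R ∧ a * (b / R ^ 2) ^ (1 / (N : ℝ)) ≤ ε := by
  have h1 : Tendsto (fun R : ℝ => b / R ^ 2) atTop (𝓝 0) :=
    tendsto_const_nhds.div_atTop (tendsto_pow_atTop two_ne_zero)
  have hN' : 0 < 1 / (N : ℝ) := by positivity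
  have h2 : Tendsto (fun R : ℝ => a * (b / R ^ 2) ^ (1 / (N : ℝ))) atTop (𝓝 0) := by
    have := (h1.rpow_const (p := 1 / (N : ℝ)) (Or.inr hN'.le)).const_mul a
    rwa [Real.zero_rpow hN'.ne', mul_zero] at this
  obtain ⟨R, hR, hR'⟩ := ((eventually_gt_atTop 0).and (h2.eventually_le_const hε)).exists
  exact ⟨R, hR, hR'⟩

/-- A supersolution cannot lie strictly below `top - d` at the centre of a ball of radius
comparable to `√d`. -/
theorem exists_radius {N : ℕ} (hN : 2 ≤ N) {α lam : ℝ} (β : ℝ) (hα : 0 < α) (hlam : 0 < lam) :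
    ∃ R : ℝ, 0 < R ∧ ∀ (Ω : Set (Rn N)) (z : Rn N → ℝ) (G A : Rn N → Rn N) (f H : Rn N → ℝ)
      (d top : ℝ) (x₀ : Rn N), IsLocalSupersolution Ω
        (Metric.closedBall x₀ (2 * (R * √d))) z G A f H α β lam d top → top - d < z x₀ := by
  obtain ⟨B, hB, hcut⟩ := exists_cutoff N
  have hN1 : (1 : NNReal) < N := by exact_mod_cast hN
  set p : NNReal := (N : NNReal).conjExponent
  have hp : NNReal.HolderConjugate (N : NNReal) p := NNReal.HolderConjugate.conjExponent hN1
  have hN0 : 0 < N := by omega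
  have hNr : (0 : ℝ) < N := by exact_mod_cast hN0
  set M := energyConst N p α β with hM
  have hM0 : 0 ≤ M := energyConst_nonneg _ _ _ _
  set c₀ := ramp 1 with hc₀
  have hc₀pos : 0 < c₀ := ramp_one_pos
  set V := (volume : Measure (Rn N)).real (Metric.closedBall 0 1) with hV
  have hV0 : 0 ≤ V := measureReal_nonneg
  set C₃ := 128 * β ^ 2 * Real.exp (2 / α) ^ 2 / (α * c₀) * B ^ 2 * 2 ^ N * V / lam with hC₃
  have hC₃0 : 0 ≤ C₃ := by positivity
  -- This is the smallness condition of the iteration after `d` and `r` have cancelled, so `R` can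
  -- be fixed before `d`, the ball and the supersolution are given.
  obtain ⟨R, hR, hR'⟩ := exists_pos_mul_rpow_le hN0 (32 * M * B) (C₃ / c₀ ^ 2)
    (ε := (1 / 4 : ℝ) ^ N) (by positivity)
  refine ⟨R, hR, fun Ω z G A f H d top x₀ hz => ?_⟩
  by_contra hcon
  rw [not_lt] at hcon
  have hd := hz.d_pos
  set r := R * √d with hr
  have hr0 : 0 < r := by positivity
  have hr2 : r ^ 2 = R ^ 2 * d := by rw [hr, mul_pow, Real.sq_sqrt hd.le]
  -- Radii shrink from `r` to `r / 2` while levels rise from `d / 4` to `d / 2`. The smoothing width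
  -- `δ j` equals the gap to the next level, which makes the next truncation dominated by the
  -- current one.
  let rad : ℕ → ℝ := fun j => r / 2 * (1 + (1 / 2) ^ j)
  let k : ℕ → ℝ := fun j => d / 2 * (1 - (1 / 2) ^ (j + 1))
  let δ : ℕ → ℝ := fun j => d / 8 * (1 / 2) ^ j
  have hrad : ∀ j, rad j - rad (j + 1) = r / (4 * 2 ^ j) := fun j => by
    simp only [rad, pow_succ, one_div, inv_pow]; field_simp; ring
  have hrad0 : ∀ j, r / 2 < rad j := fun j => by
    have : (0 : ℝ) < (1 / 2) ^ j := by positivity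
    simp only [rad]; nlinarith
  have hradle : ∀ j, rad j ≤ r := fun j => by
    have : (1 / 2 : ℝ) ^ j ≤ 1 := pow_le_one₀ (by norm_num) (by norm_num)
    simp only [rad]; nlinarith
  have hk0 : ∀ j, 0 ≤ k j := fun j => by
    have : (1 / 2 : ℝ) ^ (j + 1) ≤ 1 := pow_le_one₀ (by norm_num) (by norm_num)
    exact mul_nonneg (by positivity) (by linarith)
  have hδ0 : ∀ j, 0 < δ j := fun j => by positivity
  have hkδ : ∀ j, k (j + 1) = k j + δ j := fun j => by
    simp only [k, δ, pow_succ]; ring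
  have hkle : ∀ j, k j ≤ d / 2 := fun j => by
    have : (0 : ℝ) < (1 / 2) ^ (j + 1) := by positivity
    simp only [k]; nlinarith
  let T : ℕ → ℝ → ℝ := fun j => trunc (k j) (δ j)
  have hT : ∀ j, IsTruncation (T j) := fun j => isTruncation_trunc (hk0 j) (hδ0 j)
  have hzj : ∀ j, IsLocalSupersolution Ω (Metric.closedBall x₀ (rad j)) z G A f H α β lam d top :=
    fun j => hz.mono (isCompact_closedBall _ _)
      (Metric.closedBall_subset_closedBall (by linarith [hradle j]))
  let U : ℕ → ℝ := fun j => ∫ x in Metric.closedBall x₀ (rad j), T j (top - z x) ^ 2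
  have hU0 : ∀ j, 0 ≤ U j := fun j => integral_nonneg fun x => sq_nonneg _
  -- the recursion
  have hrec : ∀ j, U (j + 1) ≤ 32 * M * B / r * (1 / (d ^ 2 * c₀ ^ 2)) ^ (1 / (N : ℝ)) * 4 ^ j *
      U j * U j ^ (1 / (N : ℝ)) := fun j => by
    have hlt : rad (j + 1) < rad j := by
      have := hrad j
      have : 0 < r / (4 * 2 ^ j) := by positivity
      linarith
    obtain ⟨η, hη, hηs, hη0, hη1, hηe, hηg⟩ := hcut x₀ (rad j) (rad (j + 1))
      ((half_pos hr0).trans (hrad0 _)) hlt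
    have hL : B / (rad j - rad (j + 1)) = 4 * B / r * 2 ^ j := by
      rw [hrad]; field_simp
    have h1 := (hzj j).integral_sq_le hN0 (hT j) (hT (j + 1)) (k := k (j + 1))
      (m := δ j * c₀) (mul_pos (hδ0 j) hc₀pos) (fun t ht => trunc_of_le (hδ0 _) ht)
      (fun t ht => le_trunc (hδ0 j) (by rw [← hkδ]; exact ht.le))
      (fun t ht => (trunc_le (hδ0 _) ht.le).trans
        ((by rw [hkδ]; linarith : t - k (j + 1) ≤ t - k j - δ j).trans (sub_le_trunc (hδ0 j) t)))
      hη hηs hη0 hη1 (L := 4 * B / r * 2 ^ j) (by positivity) (fun x => hL ▸ hηg x)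
      (isCompact_closedBall x₀ (rad (j + 1))) (Metric.closedBall_subset_closedBall hlt.le) hηe hp
    have h2 : (U j / (δ j * c₀) ^ 2) ^ (1 / (N : ℝ)) ≤
        8 * 2 ^ j * ((1 / (d ^ 2 * c₀ ^ 2)) ^ (1 / (N : ℝ)) * U j ^ (1 / (N : ℝ))) := by
      have e1 : U j / (δ j * c₀) ^ 2 = (8 * 2 ^ j) ^ 2 * (1 / (d ^ 2 * c₀ ^ 2) * U j) := by
        simp only [δ, one_div, inv_pow]; field_simp
      -- Since `2 / N ≤ 1`, the loss from the levels is at most `8 * 2 ^ j`; with the `2 ^ j` from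
      -- the cutoff gradient this gives the factor `4 ^ j`.
      have e2 : (((8 : ℝ) * 2 ^ j) ^ 2) ^ (1 / (N : ℝ)) ≤ 8 * 2 ^ j := by
        have hone : (1 : ℝ) ≤ 8 * 2 ^ j := by
          have : (1 : ℝ) ≤ 2 ^ j := one_le_pow₀ (by norm_num)
          linarith
        have hN2 : (2 : ℝ) ≤ N := by exact_mod_cast hN
        rw [← Real.rpow_natCast, ← Real.rpow_mul (by positivity)]
        conv_rhs => rw [← Real.rpow_one (8 * 2 ^ j)]
        refine Real.rpow_le_rpow_of_exponent_le hone ?_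
        rw [mul_one_div, div_le_one hNr]
        exact_mod_cast hN2
      have hUj := hU0 j
      rw [e1, Real.mul_rpow (by positivity) (by positivity),
        Real.mul_rpow (by positivity) hUj]
      gcongr
    have hUj := hU0 j
    calc U (j + 1) ≤ M * (4 * B / r * 2 ^ j) * U j * (U j / (δ j * c₀) ^ 2) ^ (1 / (N : ℝ)) := h1
      _ ≤ M * (4 * B / r * 2 ^ j) * U j *
          (8 * 2 ^ j * ((1 / (d ^ 2 * c₀ ^ 2)) ^ (1 / (N : ℝ)) * U j ^ (1 / (N : ℝ)))) := by
          gcongr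
      _ = 32 * M * B / r * (1 / (d ^ 2 * c₀ ^ 2)) ^ (1 / (N : ℝ)) * (2 ^ j * 2 ^ j) *
          U j * U j ^ (1 / (N : ℝ)) := by ring
      _ = _ := by rw [show (2 : ℝ) ^ j * 2 ^ j = 4 ^ j by rw [← mul_pow]; norm_num]
  -- the initial step
  have hinit : U 0 ≤ C₃ * d ^ 2 * r ^ N / R ^ 2 := by
    have hrad00 : rad 0 = r := by simp only [rad, pow_zero]; ring
    obtain ⟨η, hη, hηs, hη0, hη1, hηe, hηg⟩ := hcut x₀ (2 * r) r hr0 (by linarith)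
    have hL : B / (2 * r - r) = B / r := by congr 1; ring
    have h1 := hz.integral_sq_le_of_cutoff (hT 0)
      (fun t ht => trunc_of_le (hδ0 0) (by simp only [k]; linarith))
      (fun t ht => by
        rcases le_total t (k 0) with h | h
        · exact (trunc_of_le (hδ0 0) h).le.trans ht
        · exact (trunc_le (hδ0 0) h).trans (by linarith [hk0 0]))
      hη hηs (fun x => hL ▸ hηg x) (isCompact_closedBall x₀ r)
      (Metric.closedBall_subset_closedBall (by linarith)) hηe
    have hvol : (volume : Measure (Rn N)).real (Metric.closedBall x₀ (2 * r)) =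
        (2 * r) ^ N * V := by
      rw [Measure.addHaar_real_closedBall' _ _ (by positivity), finrank_euclideanSpace_fin]
    rw [hvol] at h1
    have hU00 : U 0 = ∫ x in Metric.closedBall x₀ r, T 0 (top - z x) ^ 2 := by
      simp only [U, hrad00]
    rw [hU00]
    refine h1.trans (le_of_eq ?_)
    -- The scaling `r² = R² d` turns `d³ / r²` into `d² / R²`: the initial energy is small relative
    -- to `d² r^N` when `R` is large.
    have : (B / r) ^ 2 = B ^ 2 / (R ^ 2 * d) := by rw [div_pow, hr2]
    rw [this, hC₃, mul_pow, ← hc₀]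
    field_simp
  have hsmall : 32 * M * B / r * (1 / (d ^ 2 * c₀ ^ 2)) ^ (1 / (N : ℝ)) * U 0 ^ (1 / (N : ℝ)) ≤
      (1 / 4) ^ N := by
    refine le_trans ?_ hR'
    have h00 := hU0 0
    have h1 : (1 / (d ^ 2 * c₀ ^ 2)) ^ (1 / (N : ℝ)) * U 0 ^ (1 / (N : ℝ)) ≤
        (C₃ / c₀ ^ 2 / R ^ 2) ^ (1 / (N : ℝ)) * r := by
      have e1 : r = (r ^ N) ^ (1 / (N : ℝ)) := by
        rw [one_div, Real.pow_rpow_inv_natCast hr0.le hN0.ne']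
      conv_rhs => rw [e1]
      rw [← Real.mul_rpow (by positivity) h00, ← Real.mul_rpow (by positivity) (by positivity)]
      refine Real.rpow_le_rpow (by positivity) ?_ (by positivity)
      calc 1 / (d ^ 2 * c₀ ^ 2) * U 0 ≤
            1 / (d ^ 2 * c₀ ^ 2) * (C₃ * d ^ 2 * r ^ N / R ^ 2) := by gcongr
        _ = _ := by field_simp
    calc _ = 32 * M * B / r *
          ((1 / (d ^ 2 * c₀ ^ 2)) ^ (1 / (N : ℝ)) * U 0 ^ (1 / (N : ℝ))) := by ring
      _ ≤ 32 * M * B / r * ((C₃ / c₀ ^ 2 / R ^ 2) ^ (1 / (N : ℝ)) * r) := by gcongr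
      _ = _ := by field_simp
  have hgeo := le_geometric_of_recursion hN0.ne' (by positivity) hU0 hrec hsmall
  have hlim : Tendsto (fun j => U 0 * ((1 / 4 : ℝ) ^ N) ^ j) atTop (𝓝 0) := by
    have := (tendsto_pow_atTop_nhds_zero_of_lt_one (r := (1 / 4 : ℝ) ^ N) (by positivity)
      (pow_lt_one₀ (by norm_num) (by norm_num) hN0.ne')).const_mul (U 0)
    rwa [mul_zero] at this
  -- the lower bound near the centre
  have hx₀Ω : x₀ ∈ Ω := hz.subset (Metric.mem_closedBall_self (by positivity))
  have hcont : ContinuousAt z x₀ := hz.continuousOn.continuousAt (hz.isOpen.mem_nhds hx₀Ω)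
  have hev : ∀ᶠ x in 𝓝 x₀, z x < top - 3 / 4 * d :=
    hcont.eventually_lt_const (by linarith)
  obtain ⟨ρ, hρ, hρz⟩ := Metric.eventually_nhds_iff_ball.1 hev
  set S := Metric.ball x₀ (min ρ (r / 2)) with hS
  have hmin : 0 < min ρ (r / 2) := lt_min hρ (half_pos hr0)
  have hSpos : 0 < (volume : Measure (Rn N)).real S :=
    ENNReal.toReal_pos (Metric.measure_ball_pos _ _ hmin).ne' measure_ball_lt_top.ne
  -- On the fixed ball `S` one has `top - z > 3 d / 4`, and no level exceeds `d / 2`, so every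
  -- truncation is at least `d / 4` there and `U j` cannot tend to zero.
  have hlow : ∀ j, (d / 4) ^ 2 * (volume : Measure (Rn N)).real S ≤ U j := fun j => by
    have hsub : S ⊆ Metric.closedBall x₀ (rad j) :=
      Metric.ball_subset_closedBall.trans (Metric.closedBall_subset_closedBall
        ((min_le_right _ _).trans (hrad0 j).le))
    have hTc := (hT j).contDiff.continuous
    have hzK := (hzj j).continuousOn_K
    have iT : IntegrableOn (fun x => T j (top - z x) ^ 2) (Metric.closedBall x₀ (rad j)) :=
      (hzj j).integrableOn_comp (by fun_prop)
    calc (d / 4) ^ 2 * (volume : Measure (Rn N)).real S = ∫ x in S, (d / 4) ^ 2 := by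
          rw [setIntegral_const, smul_eq_mul, mul_comm]
      _ ≤ ∫ x in S, T j (top - z x) ^ 2 := by
          refine setIntegral_mono_on (integrableOn_const measure_ball_lt_top.ne)
            (iT.mono_set hsub) measurableSet_ball fun x hx => ?_
          have h1 := hρz x (Metric.ball_subset_ball (min_le_left _ _) hx)
          have h2 := sub_le_trunc (k := k j) (hδ0 j) (top - z x)
          have h3 := hkle (j + 1)
          rw [hkδ] at h3
          have h4 : d / 4 ≤ T j (top - z x) := by simp only [T]; linarith
          gcongr
      _ ≤ U j := setIntegral_mono_set iT (Eventually.of_forall fun x => sq_nonneg _)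
          (LE.le.eventuallyLE hsub)
  have hfin : (d / 4) ^ 2 * (volume : Measure (Rn N)).real S ≤ 0 :=
    ge_of_tendsto' hlim fun j => (hlow j).trans (hgeo j)
  have : 0 < (d / 4) ^ 2 * (volume : Measure (Rn N)).real S := by positivity
  linarith

end Radius

/-! ### Levels with summable `√(d n)` -/

section Levels

variable {h : ℝ → ℝ}

theorem intervalIntegrable_sqrt (hc : ContinuousOn h (Ioi 0)) {a b : ℝ} (ha : 0 < a) (hb : 0 < b) :
    IntervalIntegrable (fun t => √(h t)) volume a b := by
  refine ContinuousOn.intervalIntegrable fun t ht => ?_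
  have ht0 : 0 < t := (lt_min ha hb).trans_le ht.1
  exact ((hc t ht0).sqrt).mono fun y hy => (lt_min ha hb).trans_le hy.1

/-- The function `s ↦ 2 √s - ∫_s^1 √h` is a primitive of `1/√t + √h`, which dominates `√(h + 1/t)`.
As both summands are nonincreasing on the interval, the value at the upper end bounds the integral
from below. -/
theorem mul_sqrt_le_sub (hc : ContinuousOn h (Ioi 0)) (h0 : ∀ s, 0 < s → 0 ≤ h s) {δ : ℝ}
    (hanti : AntitoneOn h (Ioo 0 δ)) {a b : ℝ} (hb : 0 < b) (hba : b ≤ a) (haδ : a < δ) :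
    (a - b) * √(h a + 1 / a) ≤
      (2 * √a - ∫ t in a..1, √(h t)) - (2 * √b - ∫ t in b..1, √(h t)) := by
  have ha : 0 < a := hb.trans_le hba
  have h1 : ∫ t in b..1, √(h t) = (∫ t in b..a, √(h t)) + ∫ t in a..1, √(h t) :=
    (intervalIntegral.integral_add_adjacent_intervals (intervalIntegrable_sqrt hc hb ha)
      (intervalIntegrable_sqrt hc ha one_pos)).symm
  have h2 : (a - b) * √(h a) ≤ ∫ t in b..a, √(h t) := by
    calc (a - b) * √(h a) = ∫ _ in b..a, √(h a) := by
          rw [intervalIntegral.integral_const, smul_eq_mul]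
      _ ≤ _ := by
          refine intervalIntegral.integral_mono_on hba
            (intervalIntegrable_const) (intervalIntegrable_sqrt hc hb ha) fun t ht => ?_
          exact Real.sqrt_le_sqrt (hanti ⟨hb.trans_le ht.1, ht.2.trans_lt haδ⟩ ⟨ha, haδ⟩ ht.2)
  have h3 : (a - b) * √(1 / a) ≤ 2 * √a - 2 * √b := by
    have sa := Real.sqrt_pos.2 ha
    have sab := Real.sqrt_le_sqrt hba
    have e1 : √(1 / a) = 1 / √a := by rw [Real.sqrt_div zero_le_one, Real.sqrt_one]
    have e2 := Real.mul_self_sqrt ha.le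
    have e3 := Real.mul_self_sqrt hb.le
    rw [e1, mul_one_div, div_le_iff₀ sa]
    nlinarith
  have h4 : √(h a + 1 / a) ≤ √(h a) + √(1 / a) := by
    have e1 := Real.sq_sqrt (h0 a ha)
    have e2 := Real.sq_sqrt (by positivity : 0 ≤ 1 / a)
    rw [Real.sqrt_le_left (by positivity)]
    nlinarith [mul_nonneg (Real.sqrt_nonneg (h a)) (Real.sqrt_nonneg (1 / a))]
  have h5 := mul_le_mul_of_nonneg_left h4 (sub_nonneg.2 hba)
  rw [mul_add] at h5
  linarith

/-- Intermediate value theorem. The added `1 / (s - d)` makes the left side reach 1 by `d = s / 2`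
even if `h` vanishes, and `d ≤ s / 2` keeps the next level positive. -/
theorem exists_step (hc : ContinuousOn h (Ioi 0)) (h0 : ∀ s, 0 < s → 0 ≤ h s) {s : ℝ}
    (hs : 0 < s) : ∃ d, 0 < d ∧ d ≤ s / 2 ∧ d * (h (s - d) + 1 / (s - d)) = 1 := by
  have hcont : ContinuousOn (fun d => d * (h (s - d) + 1 / (s - d))) (Icc 0 (s / 2)) := by
    have hsub : ContinuousOn (fun d : ℝ => s - d) (Icc 0 (s / 2)) := by fun_prop
    refine continuousOn_id.mul ((hc.comp hsub fun d hd => ?_).add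
      (continuousOn_const.div hsub fun d hd => ?_))
    · have := hd.2
      simp only [mem_Ioi]; linarith
    · have := hd.2
      have : 0 < s - d := by linarith
      exact this.ne'
  have hmem : (1 : ℝ) ∈ Icc (0 * (h (s - 0) + 1 / (s - 0)))
      (s / 2 * (h (s - s / 2) + 1 / (s - s / 2))) := by
    refine ⟨by norm_num, ?_⟩
    have e : s - s / 2 = s / 2 := by ring
    have := h0 (s / 2) (by positivity)
    rw [e, mul_add, mul_one_div_cancel (by positivity)]
    have : 0 ≤ s / 2 * h (s / 2) := by positivity
    linarith
  obtain ⟨d, hd, hd1⟩ := intermediate_value_Icc (by positivity : (0 : ℝ) ≤ s / 2) hcont hmem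
  refine ⟨d, lt_of_le_of_ne hd.1 ?_, hd.2, hd1⟩
  rintro rfl
  simp at hd1

/-- Levels decreasing to zero with summable steps `√(d n)`, along which the singularity stays
below `1 / d n`. -/
theorem exists_levels (hh : IsAdmissibleSingularity h) {ε : ℝ} (hε : 0 < ε) :
    ∃ s d : ℕ → ℝ, (∀ n, 0 < s n) ∧ (∀ n, 0 < d n) ∧ (∀ n, s (n + 1) = s n - d n) ∧
      (∀ n t, s (n + 1) ≤ t → t ≤ s n + d n → h t ≤ 1 / d n) ∧
      (∀ n, ∑ j ∈ Finset.range n, √(d j) ≤ ε) ∧ ∀ m, 0 < m → ∃ n, s n < m := by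
  obtain ⟨hc, h0, ⟨L, hL⟩, δ, hδ, hanti⟩ := hh
  set Ψ : ℝ → ℝ := fun s => 2 * √s - ∫ t in s..1, √(h t) with hΨ
  have hΨL : Tendsto Ψ (𝓝[>] 0) (𝓝 (-L)) := by
    have h1 : Tendsto (fun s : ℝ => 2 * √s) (𝓝[>] 0) (𝓝 0) := by
      have := ((Real.continuous_sqrt.const_mul 2).tendsto 0).mono_left
        (nhdsWithin_le_nhds (s := Ioi 0))
      simpa using this
    simpa using h1.sub hL
  have hev : ∀ᶠ s in 𝓝[>] (0 : ℝ), |Ψ s - -L| < ε / 4 := by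
    have := Metric.tendsto_nhds.1 hΨL (ε / 4) (by positivity)
    simpa only [Real.dist_eq] using this
  obtain ⟨τ, hτ, hτΨ⟩ := (mem_nhdsGT_iff_exists_Ioo_subset).1 hev
  rw [mem_Ioi] at hτ
  choose! D hD0 hD2 hD1 using fun s (hs : 0 < s) => exists_step hc h0 hs
  -- The bound by `τ` keeps `Ψ` within `ε / 4` of its limit, the one by `δ / 2` keeps `s n + d n`
  -- where `h` is monotone, and the last one gives `√(d 0) ≤ ε / 4`.
  obtain ⟨s₀, hs₀, hs₀τ, hs₀δ, hs₀ε⟩ : ∃ s₀, 0 < s₀ ∧ s₀ < τ ∧ s₀ < δ / 2 ∧ s₀ < (ε / 4) ^ 2 := by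
    obtain ⟨s₀, h1, h2⟩ := exists_between (lt_min (lt_min hτ (half_pos hδ))
      (by positivity : (0 : ℝ) < (ε / 4) ^ 2))
    rw [lt_min_iff, lt_min_iff] at h2
    exact ⟨s₀, h1, h2.1.1, h2.1.2, h2.2⟩
  let s : ℕ → ℝ := fun n => Nat.rec s₀ (fun _ t => t - D t) n
  have hsucc : ∀ n, s (n + 1) = s n - D (s n) := fun n => rfl
  have hs0 : ∀ n, 0 < s n := fun n => by
    induction n with
    | zero => exact hs₀
    | succ n ih => rw [hsucc]; linarith [hD2 _ ih]
  have hd0 : ∀ n, 0 < D (s n) := fun n => hD0 _ (hs0 n)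
  have hsle : ∀ n, s n ≤ s₀ := fun n => by
    induction n with
    | zero => exact le_rfl
    | succ n ih => rw [hsucc]; linarith [hd0 n]
  have hsδ : ∀ n, s n < δ := fun n => by linarith [hsle n]
  have heq : ∀ n, D (s n) * (h (s (n + 1)) + 1 / s (n + 1)) = 1 := fun n => hD1 _ (hs0 n)
  have heq' : ∀ n, h (s (n + 1)) + 1 / s (n + 1) = 1 / D (s n) := fun n => by
    rw [eq_div_iff (hd0 n).ne', mul_comm]; exact heq n
  -- The increment of `Ψ` controls only `d (n + 1) / √(d n)`, with mismatched indices. The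
  -- inequality `2y ≤ y² / x + x` repairs this at the cost of `√(d n)`, which the factor 2 on the
  -- left lets one sum.
  have hstep : ∀ n, 2 * √(D (s (n + 1))) ≤ Ψ (s (n + 1)) - Ψ (s (n + 2)) + √(D (s n)) :=
    fun n => by
      have h1 := mul_sqrt_le_sub hc h0 hanti (hs0 (n + 2))
        (by rw [hsucc (n + 1)]; linarith [hd0 (n + 1)] : s (n + 2) ≤ s (n + 1)) (hsδ (n + 1))
      rw [heq', Real.sqrt_div zero_le_one, Real.sqrt_one, mul_one_div] at h1
      have e : s (n + 1) - s (n + 2) = √(D (s (n + 1))) ^ 2 := by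
        rw [Real.sq_sqrt (hd0 (n + 1)).le, show s (n + 2) = _ from hsucc (n + 1)]; ring
      rw [e] at h1
      have hx : 0 < √(D (s n)) := Real.sqrt_pos.2 (hd0 n)
      set x := √(D (s n))
      set y := √(D (s (n + 1)))
      have h2 : 2 * y ≤ y ^ 2 / x + x := by
        have : y ^ 2 / x + x - 2 * y = (y - x) ^ 2 / x := by field_simp; ring
        have h3 : 0 ≤ (y - x) ^ 2 / x := by positivity
        linarith
      linarith
  have hsum : ∀ n, ∑ j ∈ Finset.range (n + 1), √(D (s j)) + Ψ (s (n + 1)) + √(D (s n)) ≤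
      Ψ (s 1) + 2 * √(D (s 0)) := fun n => by
    induction n with
    | zero => simp only [zero_add, Finset.range_one, Finset.sum_singleton]; linarith
    | succ n ih =>
      rw [Finset.sum_range_succ]
      have := hstep n
      linarith
  have hsumε : ∀ n, ∑ j ∈ Finset.range n, √(D (s j)) ≤ ε := fun n => by
    have h1 := hsum n
    rw [Finset.sum_range_succ] at h1
    have a1 := hτΨ ⟨hs0 1, (hsle 1).trans_lt hs₀τ⟩
    have a2 := hτΨ ⟨hs0 (n + 1), (hsle (n + 1)).trans_lt hs₀τ⟩
    simp only [mem_ofPred_eq, abs_lt] at a1 a2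
    have b1 : √(D (s 0)) ≤ ε / 4 := by
      rw [Real.sqrt_le_left (by positivity)]
      have := hD2 _ (hs0 0)
      have := hsle 0
      linarith
    have b2 := Real.sqrt_nonneg (D (s n))
    linarith [a1.2, a2.1]
  refine ⟨s, fun n => D (s n), hs0, hd0, hsucc, fun n t ht1 ht2 => ?_, hsumε, fun m hm => ?_⟩
  · have := hD2 _ (hs0 n)
    have := hsle n
    have h1 : h t ≤ h (s (n + 1)) := hanti ⟨hs0 (n + 1), hsδ (n + 1)⟩
      ⟨(hs0 (n + 1)).trans_le ht1, by linarith⟩ ht1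
    have h2 : 0 ≤ 1 / s (n + 1) := by have := hs0 (n + 1); positivity
    linarith [heq' n]
  -- If the levels stayed above `m`, the steps would be bounded below by `1 / (h m + 1 / m)` and `∑
  -- √(d n)` would diverge.
  · by_contra! hcon
    set c := h m + 1 / m with hcdef
    have hc0 : 0 < c := add_pos_of_nonneg_of_pos (h0 m hm) (by positivity)
    have hlow : ∀ n, √(1 / c) ≤ √(D (s n)) := fun n => by
      refine Real.sqrt_le_sqrt ?_
      have hle : h (s (n + 1)) + 1 / s (n + 1) ≤ c := by
        refine add_le_add (hanti ⟨hm, (hcon (n + 1)).trans_lt (hsδ (n + 1))⟩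
          ⟨hs0 (n + 1), hsδ (n + 1)⟩
          (hcon (n + 1))) (one_div_le_one_div_of_le hm (hcon (n + 1)))
      rw [heq'] at hle
      rw [div_le_iff₀ hc0, mul_comm]
      rwa [div_le_iff₀ (hd0 n)] at hle
    have hpos : 0 < √(1 / c) := Real.sqrt_pos.2 (by positivity)
    obtain ⟨n, hn⟩ := exists_nat_gt (ε / √(1 / c))
    rw [div_lt_iff₀ hpos] at hn
    have : (n : ℝ) * √(1 / c) ≤ ∑ j ∈ Finset.range n, √(D (s j)) := by
      calc (n : ℝ) * √(1 / c) = ∑ j ∈ Finset.range n, √(1 / c) := by simp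
        _ ≤ _ := Finset.sum_le_sum fun j _ => hlow j
    linarith [hsumε n]

end Levels

/-! ### Measurability of the flux and uniqueness of the weak gradient -/

theorem aemeasurable_comp_caratheodory {X : Type*} [MeasurableSpace X] {μ : Measure X}
    {m : X → ℝ → ℝ} (hm : ∀ s, AEMeasurable (fun x => m x s) μ)
    (hc : ∀ᵐ x ∂μ, Continuous (m x)) {u : X → ℝ} (hu : AEMeasurable u μ) :
    AEMeasurable (fun x => m x (u x)) μ := by
  set v := hu.mk u with hv
  have hvm : Measurable v := hu.measurable_mk
  -- Rounding `v` down to a grid leaves countably many values of the second variable, so the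
  -- exceptional null sets can be united; continuity in `s` then gives the limit.
  have happrox : ∀ n : ℕ, AEMeasurable
      (fun x => m x ((⌊((n : ℝ) + 1) * v x⌋ : ℝ) / ((n : ℝ) + 1))) μ := fun n => by
    let m' : X × ℤ → ℝ := fun p => (hm ((p.2 : ℝ) / ((n : ℝ) + 1))).mk _ p.1
    have hm' : Measurable m' := measurable_from_prod_countable_left fun k =>
      (hm ((k : ℝ) / ((n : ℝ) + 1))).measurable_mk
    have hall : ∀ᵐ x ∂μ, ∀ k : ℤ, m x ((k : ℝ) / ((n : ℝ) + 1)) = m' (x, k) :=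
      ae_all_iff.2 fun k => (hm ((k : ℝ) / ((n : ℝ) + 1))).ae_eq_mk
    have hfl : Measurable fun x => ⌊((n : ℝ) + 1) * v x⌋ :=
      Int.measurable_floor.comp (hvm.const_mul _)
    exact ⟨fun x => m' (x, ⌊((n : ℝ) + 1) * v x⌋), hm'.comp (measurable_id.prodMk hfl),
      hall.mono fun x hx => hx _⟩
  have hlim : AEMeasurable (fun x => m x (v x)) μ := by
    refine aemeasurable_of_tendsto_metrizable_ae atTop happrox ?_
    filter_upwards [hc] with x hx
    refine (hx.tendsto (v x)).comp ?_
    rw [tendsto_iff_dist_tendsto_zero]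
    refine squeeze_zero (fun _ => dist_nonneg) (fun n => ?_) tendsto_one_div_add_atTop_nhds_zero_nat
    have hn : (0 : ℝ) < (n : ℝ) + 1 := by positivity
    have h1 := Int.floor_le (((n : ℝ) + 1) * v x)
    have h2 := Int.lt_floor_add_one (((n : ℝ) + 1) * v x)
    have e : (⌊((n : ℝ) + 1) * v x⌋ : ℝ) / ((n : ℝ) + 1) - v x =
        (⌊((n : ℝ) + 1) * v x⌋ - ((n : ℝ) + 1) * v x) / ((n : ℝ) + 1) := by field_simp
    rw [Real.dist_eq, e, abs_div, abs_of_pos hn]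
    gcongr
    rw [abs_le]
    constructor <;> linarith
  exact hlim.congr (hu.ae_eq_mk.mono fun x hx => by simp only [hx, hv])

/-- Membership in `H¹_loc` and the supersolution property each provide their own weak gradient. The
fundamental lemma of the calculus of variations identifies them, so the second one is also in
`L²_loc`. -/
theorem HasWeakGradient.ae_eq {N : ℕ} {Ω : Set (Rn N)} (hΩ : IsOpen Ω) {u : Rn N → ℝ}
    {G₁ G₂ : Rn N → Rn N} (h₁ : HasWeakGradient Ω u G₁) (h₂ : HasWeakGradient Ω u G₂) :
    ∀ᵐ x ∂volume.restrict Ω, G₁ x = G₂ x := by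
  have hint : ∀ {G : Rn N → Rn N}, HasWeakGradient Ω u G → ∀ (i : Fin N) {K : Set (Rn N)},
      IsCompact K → K ⊆ Ω → IntegrableOn (fun x => G x i) K := fun {G} hG i K hK hKΩ =>
    (EuclideanSpace.proj i : Rn N →L[ℝ] ℝ).integrable_comp
      (memLp_one_iff_integrable.1 (hG.2.1.memLp_isCompact hΩ hK hKΩ))
  have hcomp : ∀ i : Fin N, ∀ᵐ x ∂(volume : Measure (Rn N)), x ∈ Ω → G₁ x i - G₂ x i = 0 := by
    intro i
    refine hΩ.ae_eq_zero_of_integral_contDiff_smul_eq_zero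
      ((locallyIntegrableOn_iff hΩ.isLocallyClosed).2 fun K hKΩ hK =>
        (hint h₁ i hK hKΩ).sub (hint h₂ i hK hKΩ)) fun φ hφ hφc hφΩ => ?_
    have hK : IsCompact (tsupport φ) := hφc
    have h0 : ∀ x, x ∉ tsupport φ → φ x = 0 := fun x hx => image_eq_zero_of_notMem_tsupport hx
    have e1 := h₁.2.2 φ ⟨hφ, hφc, hφΩ⟩ i
    have e2 := h₂.2.2 φ ⟨hφ, hφc, hφΩ⟩ i
    rw [e1, neg_inj, integral_eq_of_tsupport_subset hΩ hφΩ fun x hx => by rw [h0 x hx, mul_zero],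
      integral_eq_of_tsupport_subset hΩ hφΩ fun x hx => by rw [h0 x hx, mul_zero]] at e2
    have i1 : IntegrableOn (fun x => G₁ x i * φ x) (tsupport φ) :=
      (hint h₁ i hK hφΩ).mul_continuousOn hφ.continuous.continuousOn hK
    have i2 : IntegrableOn (fun x => G₂ x i * φ x) (tsupport φ) :=
      (hint h₂ i hK hφΩ).mul_continuousOn hφ.continuous.continuousOn hK
    rw [← setIntegral_eq_integral_of_forall_compl_eq_zero (s := tsupport φ) fun x hx => by
      rw [h0 x hx, zero_smul]]
    calc ∫ x in tsupport φ, φ x • (G₁ x i - G₂ x i) =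
          ∫ x in tsupport φ, (G₁ x i * φ x - G₂ x i * φ x) :=
          integral_congr_ae (Eventually.of_forall fun x => by simp only [smul_eq_mul]; ring)
      _ = 0 := by rw [integral_sub i1 i2, e2, sub_self]
  rw [ae_restrict_iff' hΩ.measurableSet]
  filter_upwards [ae_all_iff.2 hcomp] with x hx hxΩ
  ext i
  exact sub_eq_zero.1 (hx i hxΩ)

theorem memLp_flux {N : ℕ} {Ω K : Set (Rn N)} (hKΩ : K ⊆ Ω)
    {M : Rn N → ℝ → Matrix (Fin N) (Fin N) ℝ} (hM : IsCaratheodoryMatrix Ω M) {α β : ℝ}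
    (hell : IsUniformlyElliptic Ω M α β) {z : Rn N → ℝ} (hz : AEMeasurable z (volume.restrict K))
    {G : Rn N → Rn N} (hG : MemLp G 2 (volume.restrict K)) :
    MemLp (fun x => Matrix.toEuclideanCLM (𝕜 := ℝ) (M x (z x)) (G x)) 2 (volume.restrict K) := by
  have hm : (volume : Measure (Rn N)).restrict K ≤ volume.restrict Ω :=
    Measure.restrict_mono hKΩ le_rfl
  have hmeas : AEMeasurable (fun x => Matrix.toEuclideanCLM (𝕜 := ℝ) (M x (z x)) (G x))
      (volume.restrict K) := by
    have h1 : AEMeasurable (fun x => fun i => ∑ j, M x (z x) i j * G x j)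
        (volume.restrict K) := by
      refine aemeasurable_pi_lambda _ fun i => Finset.aemeasurable_fun_sum _ fun j _ => ?_
      refine (aemeasurable_comp_caratheodory (fun s => ((hM i j).1 s).mono_measure hm)
        (ae_mono hm (hM i j).2) hz).mul ?_
      exact (EuclideanSpace.proj j : Rn N →L[ℝ] ℝ).continuous.measurable.comp_aemeasurable
        hG.1.aemeasurable
    exact (WithLp.measurable_toLp 2 _).comp_aemeasurable h1
  refine hG.of_le_mul (c := β) hmeas.aestronglyMeasurable ?_
  filter_upwards [ae_mono hm hell] with x hx
  exact (ContinuousLinearMap.le_opNorm _ _).trans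
    (mul_le_mul_of_nonneg_right (hx (z x) 0).2 (norm_nonneg _))

end QuasilinearElliptic

/-! ### The chain of points -/

open QuasilinearElliptic

theorem mainTheorem7 (N : ℕ) (hN : 2 ≤ N)
    (Ω : Set (QuasilinearElliptic.Rn N)) (hΩ : IsOpen Ω) (hΩb : Bornology.IsBounded Ω)
    (M : QuasilinearElliptic.Rn N → ℝ → Matrix (Fin N) (Fin N) ℝ)
    (hM : QuasilinearElliptic.IsCaratheodoryMatrix Ω M)
    (α β : ℝ) (hα : 0 < α) (hαβ : α ≤ β)
    (hell : QuasilinearElliptic.IsUniformlyElliptic Ω M α β)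
    (f : QuasilinearElliptic.Rn N → ℝ)
    (hf : QuasilinearElliptic.MemLpLoc f ⊤ Ω)
    (hfpos : QuasilinearElliptic.LocallyEssPositive Ω f)
    (h : ℝ → ℝ) (hh : QuasilinearElliptic.IsAdmissibleSingularity h)
    (ω : Set (QuasilinearElliptic.Rn N))
    (hω : QuasilinearElliptic.CompactlyContained ω Ω) :
    ∃ c : ℝ, 0 < c ∧
      ∀ z : QuasilinearElliptic.Rn N → ℝ,
        (∀ x ∈ Ω, 0 < z x) → ContinuousOn z Ω → QuasilinearElliptic.MemH1Loc Ω z →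
        QuasilinearElliptic.IsSupersolution Ω M (fun _ s => h s) f z →
        ∀ x ∈ ω, c ≤ z x := by
  obtain ⟨ε, hε, hεΩ⟩ := hω.2.1.exists_cthickening_subset_open hΩ hω.2.2
  set K := Metric.cthickening ε (closure ω) with hKdef
  have hK : IsCompact K := hω.2.1.cthickening
  obtain ⟨ε', hε', hεΩ'⟩ := hK.exists_cthickening_subset_open hΩ hεΩ
  obtain ⟨lam, hlam, hlamf⟩ := EReal.lt_iff_exists_real_btwn.1
    (hfpos _ (compactlyContained_thickening hK hεΩ'))
  have hlam0 : 0 < lam := by exact_mod_cast hlam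
  have hfK : ∀ᵐ x ∂volume.restrict K, lam ≤ f x := by
    have h1 := ae_lt_of_lt_essInf hlamf
    have h2 := ae_mono (Measure.restrict_mono (Metric.self_subset_thickening hε' K) le_rfl) h1
    filter_upwards [h2] with x hx
    exact (EReal.coe_lt_coe_iff.1 hx).le
  obtain ⟨R, hR, hrad⟩ := exists_radius hN β hα hlam0
  -- The chain moves by at most `2 R √(d j)` at each step, so this bound on the sum keeps it within
  -- `ε` of its start.
  obtain ⟨s, d, hs, hd, hsucc, hlev, hsum, hszero⟩ :=
    exists_levels hh (ε := ε / (2 * R)) (by positivity)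
  refine ⟨s 0, hs 0, fun z hzpos hzc hzH ⟨G, hG, _, hHloc, hineq⟩ x hx => ?_⟩
  obtain ⟨G', hG', _, hG'2⟩ := hzH
  have hG2 : MemLpLoc G 2 Ω := fun V hV =>
    (hG'2 V hV).ae_eq (ae_mono (Measure.restrict_mono (subset_closure.trans hV.2.2) le_rfl)
      (hG'.ae_eq hΩ hG))
  by_contra hcon
  rw [not_le] at hcon
  have hdist : ∀ n, 2 * R * ∑ j ∈ Finset.range n, √(d j) ≤ ε := fun n => by
    have := hsum n
    rw [le_div_iff₀ (by positivity)] at this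
    linarith
  have hballK : Metric.closedBall x ε ⊆ K := fun y hy =>
    Metric.mem_cthickening_of_dist_le y x ε _ (subset_closure hx) hy
  have chain : ∀ n, ∃ y, dist y x ≤ 2 * R * ∑ j ∈ Finset.range n, √(d j) ∧ z y ≤ s n := by
    intro n
    induction n with
    | zero => exact ⟨x, by simp, hcon.le⟩
    | succ n ih =>
      obtain ⟨y, hyx, hzy⟩ := ih
      set B := Metric.closedBall y (2 * (R * √(d n))) with hB
      have hBx : ∀ y' ∈ B, dist y' x ≤ 2 * R * ∑ j ∈ Finset.range (n + 1), √(d j) :=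
        fun y' hy' => by
          have h1 := dist_triangle y' y x
          have h2 := Metric.mem_closedBall.1 hy'
          rw [Finset.sum_range_succ]
          linarith
      have hBK : B ⊆ K := fun y' hy' => hballK ((hBx y' hy').trans (hdist _))
      have hBΩ : B ⊆ Ω := hBK.trans hεΩ
      -- If the chain could not be continued, then `z > s (n + 1)` on all of `B`. With `top = s n +
      -- d n` one has `top - 2 d n = s (n + 1)` and `top - d n = s n`, so the estimate at the centre
      -- contradicts `z y ≤ s n`.
      by_contra! hno
      have hBc : IsCompact B := isCompact_closedBall _ _
      have hm : (volume : Measure (Rn N)).restrict B ≤ volume.restrict Ω :=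
        Measure.restrict_mono hBΩ le_rfl
      have hzB : AEMeasurable z (volume.restrict B) :=
        (hzc.mono hBΩ).aemeasurable hBc.measurableSet
      have := isFiniteMeasure_restrict_of_isCompact hBc
      have hfB : IntegrableOn f B :=
        (hf.memLp_isCompact hΩ hBc hBΩ).integrable le_top
      have hloc : IsLocalSupersolution Ω B z G
          (fun x => Matrix.toEuclideanCLM (𝕜 := ℝ) (M x (z x)) (G x)) f
          (fun x => h (z x) * ‖G x‖ ^ 2) α β lam (d n) (s n + d n) :=
        { isOpen := hΩ
          weakGradient := hG
          continuousOn := hzc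
          memLp := hG2
          isCompact := hBc
          subset := hBΩ
          memLp_flux := memLp_flux hBΩ hM hell hzB (hG2.memLp_isCompact hΩ hBc hBΩ)
          integrable_source := hfB
          integrable_lower := memLp_one_iff_integrable.1 (hHloc.memLp_isCompact hΩ hBc hBΩ)
          ineq := hineq
          coercive := Eventually.mono (ae_mono hm hell) fun x hx => (hx (z x) (G x)).1
          bounded := Eventually.mono (ae_mono hm hell) fun x hx =>
            (ContinuousLinearMap.le_opNorm _ _).trans
              (mul_le_mul_of_nonneg_right (hx (z x) 0).2 (norm_nonneg _))
          le_source := ae_mono (Measure.restrict_mono hBK le_rfl) hfK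
          lower_le := by
            filter_upwards [ae_restrict_mem hBc.measurableSet] with y' hy' htop
            exact mul_le_mul_of_nonneg_right
              (hlev n _ (hno y' (hBx y' hy')).le htop) (sq_nonneg _)
          le_z := fun y' hy' => by
            have h1 := (hno y' (hBx y' hy')).le
            rw [hsucc] at h1
            linarith
          alpha_pos := hα
          beta_nonneg := hα.le.trans hαβ
          lam_pos := hlam0
          d_pos := hd n }
      have := hrad _ _ _ _ _ _ _ _ _ hloc
      linarith
  have hxK : x ∈ K := hballK (Metric.mem_closedBall_self hε.le)
  obtain ⟨y₀, hy₀, hmin⟩ := hK.exists_isMinOn ⟨x, hxK⟩ (hzc.mono hεΩ)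
  obtain ⟨n, hn⟩ := hszero (z y₀) (hzpos y₀ (hεΩ hy₀))
  obtain ⟨y, hy, hzy⟩ := chain n
  have := isMinOn_iff.1 hmin y (hballK (hy.trans (hdist n)))
  linarith
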